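/- Let $a,b,d\in C^0[0,1]$ and $\lambda\in\mathbb R$, $\beta\ge 0$. Call a function $g$ weakly degenerate if $g\in C^0[0,1]\cap C^1(0,1]$, $g(0)=0$, $g>0$ on $(0,1]$ and $K_g:=\sup_{x\in(0,1]}\frac{x|g'(x)|}{g(x)}\in(0,1)$, and strongly degenerate if $g\in C^1[0,1]$, $g(0)=0$, $g>0$ on $(0,1]$ and $K_g\in[1,2)$. Assume that each of $a$ and $d$ is weakly or strongly degenerate, that $\frac ba\in L^1(0,1)$, that $K_a+2K_d\le 2$, and that $\frac{xb}{a}\in L^\infty(0,1)$ if $K_a>1$. Put $\eta(x):=\exp\int_{1/2}^x\frac{b(s)}{a(s)}\,ds$ and $\sigma:=\frac a\eta$ on $[0,1]$, and let $$L^2_{1/\sigma}:=\Big\{u\in L^2(0,1):\int_0^1\frac{u^2}{\sigma}\,dx<\infty\Big\},\qquad H^1_{1/\sigma,0}:=\{u\in L^2_{1/\sigma}\cap H^1(0,1):u(0)=0\},$$ with norms $\|u\|_{1/\sigma}^2=\int_0^1\frac{u^2}{\sigma}dx$ and $\|u\|_{1/\sigma}^2+\int_0^1\eta (u')^2dx$.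 Let $\tilde C_{HP}$ and $C_{HP}$ be the best constants in $$\int_0^1\frac{u^2}{\sigma}\,dx\le \tilde C_{HP}\int_0^1(u')^2dx\qquad\text{and}\qquad \int_0^1\frac{u^2}{\sigma d}\,dx\le C_{HP}\int_0^1\eta(u')^2dx\qquad (u\in H^1_{1/\sigma,0}),$$ and assume $\lambda<\frac1{C_{HP}}$. Put $\boldsymbol{1_\varepsilon}:=1$ if $\lambda\le0$ and $\boldsymbol{1_\varepsilon}:=\varepsilon$ if $\lambda>0$, where $\varepsilon$ is given by $\lambda=\frac{1-\varepsilon}{C_{HP}}$; and put $C_\lambda:=(\min_{[0,1]}\eta)^{-1/2}$ if $\lambda\le 0$ and $C_\lambda:=(\varepsilon\min_{[0,1]}\eta)^{-1/2}$ if $\lambda>0$. Let $Au:=\sigma(\eta u')'$ and $A_\lambda u:=Au+\lambda\frac ud$, where $D(A_\lambda)$ is the set of $u\in H^1_{1/\sigma,0}$ with $Au,A_\lambda u\in L^2_{1/\sigma}$, with the norm given by the norms of $u$ in $H^1_{1/\sigma,0}$ and of $Au$, $A_\lambda u$ in $L^2_{1/\sigma}$. Let $y$ be a classical solution of $$\begin{cases}y_{tt}-a\,y_{xx}-b\,y_x-\frac{\lambda}{d}\,y=0,&(t,x)\in(0,\infty)\times(0,1),\\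 y_t(t,1)+\eta(1)\, y_x(t,1)+\beta y(t,1)=0,&t>0,\\ y(t,0)=0,&t>0,\\ y(0,\cdot)=y_0,\quad y_t(0,\cdot)=y_1,\end{cases}$$ that is, $y\in C^2([0,\infty);L^2_{1/\sigma})\cap C^1([0,\infty);H^1_{1/\sigma,0})\cap C([0,\infty);D(A_\lambda))$, the equation $y_{tt}=A_\lambda y$ holds in $L^2_{1/\sigma}$ for all $t\ge0$, and the boundary and initial conditions hold. Let $$E_y(t):=\frac12\left[\int_0^1\Big(\frac{1}{\sigma}y_t^2(t,x)+\eta\, y_x^2(t,x)-\frac{\lambda}{\sigma d}y^2(t,x)\Big)dx+\beta y^2(t,1)\right].$$ Then $\boldsymbol{1_\varepsilon}\in(0,1]$, and for all $T>s>0$ and all $\delta>0$, $$\begin{aligned}\int_s^Ty^2(t,1)\,dt\le{}&\left(\frac{2}{\boldsymbol{1_\varepsilon}}\Big(1+\frac{\tilde C_{HP}C_\lambda^2}{\boldsymbol{1_\varepsilon}(\min_{[0,1]}\eta)^2}\Big)+\frac1{2\delta}+\frac{1}{2\delta}\big(\tilde C_{HP}+\max_{[0,1]}\eta\big)C_\lambda^4\right)E_y(s)\\&+\frac{\delta}{\boldsymbol{1_\varepsilon}}\left(1+\frac{1}{\boldsymbol{1_\varepsilon}(\min_{[0,1]}\eta)^2}C_\lambda^2\right)\int_s^TE_y(t)\,dt.\end{aligned}$$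 -/

import Mathlib

open MeasureTheory Set

noncomputable section

namespace DegWave

/-- `K` is the degeneracy constant `K_g = sup_{x ∈ (0,1]} x |g'(x)| / g(x)` of `g` (as a genuine,
finite supremum). The derivative at `x = 1` is the one-sided one. -/
def IsDegConst (g : ℝ → ℝ) (K : ℝ) : Prop :=
  IsLUB ((fun x => x * |derivWithin g (Ioc 0 1) x| / g x) '' Ioc 0 1) K

/-- `g` is weakly degenerate at `0`, with `K_g = K ∈ (0,1)`. -/
structure WeaklyDegenerate (g : ℝ → ℝ) (K : ℝ) : Prop where
  cont : ContinuousOn g (Icc 0 1)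
  c1 : ContDiffOn ℝ 1 g (Ioc 0 1)
  zero : g 0 = 0
  pos : ∀ x ∈ Ioc (0 : ℝ) 1, 0 < g x
  const : IsDegConst g K
  mem : K ∈ Ioo (0 : ℝ) 1

/-- `g` is strongly degenerate at `0`, with `K_g = K ∈ [1,2)`. -/
structure StronglyDegenerate (g : ℝ → ℝ) (K : ℝ) : Prop where
  c1 : ContDiffOn ℝ 1 g (Icc 0 1)
  zero : g 0 = 0
  pos : ∀ x ∈ Ioc (0 : ℝ) 1, 0 < g x
  const : IsDegConst g K
  mem : K ∈ Ico (1 : ℝ) 2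

/-- The weight `η(x) = exp (∫_{1/2}^x b/a)`. -/
def eta (a b : ℝ → ℝ) (x : ℝ) : ℝ := Real.exp (∫ s in (1 / 2 : ℝ)..x, b s / a s)

/-- `σ = a / η`. -/
def sigma (a b : ℝ → ℝ) (x : ℝ) : ℝ := a x / eta a b x

/-- `min_{[0,1]} η`. -/
def etaMin (a b : ℝ → ℝ) : ℝ := sInf (eta a b '' Icc 0 1)

/-- `max_{[0,1]} η`. -/
def etaMax (a b : ℝ → ℝ) : ℝ := sSup (eta a b '' Icc 0 1)

/-- Lebesgue measure on `(0,1)`. -/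
abbrev vol01 : Measure ℝ := volume.restrict (Ioo 0 1)

/-- The measure `(1/σ) dx` on `(0,1)`. -/
def muSigma (a b : ℝ → ℝ) : Measure ℝ :=
  vol01.withDensity (fun x => ENNReal.ofReal (1 / sigma a b x))

/-- The weighted Hilbert space `L²_{1/σ}(0,1)`, with norm `‖u‖² = ∫₀¹ u²/σ`. (As `1/σ` is bounded
below by a positive constant, such a `u` lies in `L²(0,1)`.) -/
abbrev L2Sigma (a b : ℝ → ℝ) : Type := Lp ℝ 2 (muSigma a b)

/-- The space `H¹_{1/σ,0}(0,1)` of the `u ∈ L²_{1/σ}(0,1) ∩ H¹(0,1)` with `u(0) = 0`. Its elements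
are the pairs `(u, u')` with `u ∈ L²_{1/σ}(0,1)`, `u' ∈ L²(0,1)` and `u(x) = ∫₀ˣ u'` for almost
every `x`: this says that `u` is (the class of) an absolutely continuous function that vanishes at
`0` and has the square integrable weak derivative `u'`. The norm is
`(∫₀¹ u²/σ + ∫₀¹ (u')²)^{1/2}`; it is equivalent to `(∫₀¹ u²/σ + ∫₀¹ η (u')²)^{1/2}`, because `η`
is bounded above and below by positive constants. -/
def H1Sigma0 (a b : ℝ → ℝ) : Submodule ℝ (WithLp 2 (L2Sigma a b × Lp ℝ 2 vol01)) where
  carrier := {p | ∀ᵐ x ∂(muSigma a b), x ∈ Ioo (0 : ℝ) 1 → p.fst x = ∫ s in (0 : ℝ)..x, p.snd s}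
  zero_mem' := by
    have h2 : ∀ x ∈ Ioo (0 : ℝ) 1, ∫ s in (0 : ℝ)..x, (0 : Lp ℝ 2 vol01) s = 0 := by
      intro x hx
      rw [intervalIntegral.integral_of_le hx.1.le]
      apply integral_eq_zero_of_ae
      have h := Lp.coeFn_zero ℝ 2 vol01
      refine ae_mono (Measure.restrict_mono' ?_ le_rfl) h
      exact (Ioc_subset_Ioo_right hx.2).eventuallyLE
    filter_upwards [Lp.coeFn_zero ℝ 2 (muSigma a b)] with x h1 hx
    change (0 : L2Sigma a b) x = ∫ s in (0 : ℝ)..x, (0 : Lp ℝ 2 vol01) s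
    rw [h2 x hx, h1]; rfl
  add_mem' := by
    intro p q hp hq
    have hint : ∀ (v : Lp ℝ 2 vol01), ∀ x ∈ Ioo (0 : ℝ) 1,
        IntervalIntegrable (v : ℝ → ℝ) volume 0 x := by
      intro v x hx
      rw [intervalIntegrable_iff_integrableOn_Ioc_of_le hx.1.le]
      have h : IntegrableOn (v : ℝ → ℝ) (Ioo 0 1) := (Lp.memLp v).integrable (by norm_num)
      exact h.mono_set (Ioc_subset_Ioo_right hx.2)
    have h2 : ∀ x ∈ Ioo (0 : ℝ) 1, ∫ s in (0 : ℝ)..x, (p.snd + q.snd : Lp ℝ 2 vol01) s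
        = (∫ s in (0 : ℝ)..x, p.snd s) + ∫ s in (0 : ℝ)..x, q.snd s := by
      intro x hx
      rw [← intervalIntegral.integral_add (hint _ x hx) (hint _ x hx)]
      rw [intervalIntegral.integral_of_le hx.1.le, intervalIntegral.integral_of_le hx.1.le]
      apply integral_congr_ae
      refine ae_mono (Measure.restrict_mono' ?_ le_rfl) (Lp.coeFn_add p.snd q.snd)
      exact (Ioc_subset_Ioo_right hx.2).eventuallyLE
    filter_upwards [hp, hq, Lp.coeFn_add p.fst q.fst] with x h3 h4 h1 hx
    change (p.fst + q.fst : L2Sigma a b) x = ∫ s in (0 : ℝ)..x, (p.snd + q.snd : Lp ℝ 2 vol01) s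
    rw [h2 x hx, h1, ← h3 hx, ← h4 hx]; rfl
  smul_mem' := by
    intro r p hp
    have h2 : ∀ x ∈ Ioo (0 : ℝ) 1, ∫ s in (0 : ℝ)..x, (r • p.snd : Lp ℝ 2 vol01) s
        = r * ∫ s in (0 : ℝ)..x, p.snd s := by
      intro x hx
      rw [← intervalIntegral.integral_const_mul]
      rw [intervalIntegral.integral_of_le hx.1.le, intervalIntegral.integral_of_le hx.1.le]
      apply integral_congr_ae
      refine ae_mono (Measure.restrict_mono' ?_ le_rfl) (Lp.coeFn_smul r p.snd)
      exact (Ioc_subset_Ioo_right hx.2).eventuallyLE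
    filter_upwards [hp, Lp.coeFn_smul r p.fst] with x h3 h1 hx
    change (r • p.fst : L2Sigma a b) x = ∫ s in (0 : ℝ)..x, (r • p.snd : Lp ℝ 2 vol01) s
    rw [h2 x hx, h1, ← h3 hx]; rfl

variable {a b : ℝ → ℝ}

/-- `u ∈ H¹_{1/σ,0}(0,1)` as an element of `L²_{1/σ}(0,1)`. -/
def toL2 (u : H1Sigma0 a b) : L2Sigma a b := u.val.fst

/-- The weak derivative `u'` of `u ∈ H¹_{1/σ,0}(0,1)`. -/
def dx (u : H1Sigma0 a b) : ℝ → ℝ := u.val.snd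

/-- The value at `x ∈ [0,1]` of (the continuous representative of) `u ∈ H¹_{1/σ,0}(0,1)`. -/
def val (u : H1Sigma0 a b) (x : ℝ) : ℝ := ∫ s in (0 : ℝ)..x, dx u s

variable (a b)

/-- The best constant in `∫₀¹ u²/σ ≤ C ∫₀¹ (u')²`, `u ∈ H¹_{1/σ,0}(0,1)`. -/
def hardyTilde : ℝ :=
  sInf {C : ℝ | 0 ≤ C ∧ ∀ u : H1Sigma0 a b,
    IntervalIntegrable (fun x => val u x ^ 2 / sigma a b x) volume 0 1 ∧
    ∫ x in (0 : ℝ)..1, val u x ^ 2 / sigma a b x ≤ C * ∫ x in (0 : ℝ)..1, dx u x ^ 2}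

/-- The best constant in `∫₀¹ u²/(σd) ≤ C ∫₀¹ η (u')²`, `u ∈ H¹_{1/σ,0}(0,1)`. -/
def hardy (d : ℝ → ℝ) : ℝ :=
  sInf {C : ℝ | 0 ≤ C ∧ ∀ u : H1Sigma0 a b,
    IntervalIntegrable (fun x => val u x ^ 2 / (sigma a b x * d x)) volume 0 1 ∧
    ∫ x in (0 : ℝ)..1, val u x ^ 2 / (sigma a b x * d x)
      ≤ C * ∫ x in (0 : ℝ)..1, eta a b x * dx u x ^ 2}

/-- The number `1_ε`: it is `1` if `lam ≤ 0`, and the `ε` with `lam = (1 - ε) / C_HP` otherwise. -/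
def oneEps (d : ℝ → ℝ) (lam : ℝ) : ℝ := if lam ≤ 0 then 1 else 1 - lam * hardy a b d

/-- `C_lam = (min η)^{-1/2}` if `lam ≤ 0`, and `(ε min η)^{-1/2}` with the `ε` such that
`lam = (1 - ε) / C_HP` otherwise. -/
def cLam (d : ℝ → ℝ) (lam : ℝ) : ℝ :=
  if lam ≤ 0 then 1 / Real.sqrt (etaMin a b)
  else 1 / Real.sqrt ((1 - lam * hardy a b d) * etaMin a b)

/-- The standing assumptions on the coefficients, with `Ka`, `Kd` the degeneracy constants of
`a` and `d`. -/
structure Assumptions (d : ℝ → ℝ) (lam Ka Kd : ℝ) : Prop where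
  deg_a : WeaklyDegenerate a Ka ∨ StronglyDegenerate a Ka
  deg_d : WeaklyDegenerate d Kd ∨ StronglyDegenerate d Kd
  cont_b : ContinuousOn b (Icc 0 1)
  int_ba : IntegrableOn (fun x => b x / a x) (Ioo 0 1)
  exps : Ka + 2 * Kd ≤ 2
  bdd : 1 < Ka → MemLp (fun x => x * b x / a x) ⊤ vol01
  lam_lt : lam < 1 / hardy a b d

variable {a b}

/-- `u ∈ D(A)` with `A u = σ (η u')' = f ∈ L²_{1/σ}(0,1)` and `(η u')(1) = c`: the function
`η u'` is (almost everywhere equal to) a function that is locally absolutely continuous on `(0,1]`,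
with derivative `f/σ` and with value `c` at `1`. -/
def HasOpA (u : H1Sigma0 a b) (f : L2Sigma a b) (c : ℝ) : Prop :=
  ∀ᵐ x ∂vol01, eta a b x * dx u x = c - ∫ s in x..1, f s / sigma a b s

/-- `u ∈ D(A)` and `A_lam u = A u + lam u/d = g ∈ L²_{1/σ}(0,1)`, where `f = A u`. -/
def HasOpALam (d : ℝ → ℝ) (lam : ℝ) (u : H1Sigma0 a b) (f g : L2Sigma a b) (c : ℝ) : Prop :=
  HasOpA u f c ∧ ∀ᵐ x ∂vol01, g x = f x + lam * val u x / d x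

/-- The time derivative `y_t(t) ∈ L²_{1/σ}(0,1)` of a curve `y` in `H¹_{1/σ,0}(0,1)`, as a curve
in `L²_{1/σ}(0,1)` (one-sided at `t = 0`). -/
def dt (y : ℝ → H1Sigma0 a b) (t : ℝ) : L2Sigma a b :=
  derivWithin (fun r => toL2 (y r)) (Ici 0) t

/-- The second time derivative `y_tt(t) ∈ L²_{1/σ}(0,1)`. -/
def dtt (y : ℝ → H1Sigma0 a b) (t : ℝ) : L2Sigma a b := derivWithin (dt y) (Ici 0) t

/-- `y` is a classical solution, with initial data `y₀`, `y₁`, of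
`y_tt - a y_xx - b y_x - (lam/d) y = 0` on `(0,∞) × (0,1)`, `y(t,0) = 0`,
`y_t(t,1) + η(1) y_x(t,1) + β y(t,1) = 0`. -/
structure IsClassicalSolution (d : ℝ → ℝ) (lam β : ℝ) (y₀ : H1Sigma0 a b) (y₁ : L2Sigma a b)
    (y : ℝ → H1Sigma0 a b) : Prop where
  /-- `y ∈ C²([0,∞); L²_{1/σ}(0,1))` -/
  c2_L2 : ContDiffOn ℝ 2 (fun t => toL2 (y t)) (Ici 0)
  /-- `y ∈ C¹([0,∞); H¹_{1/σ,0}(0,1))` -/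
  c1_H1 : ContDiffOn ℝ 1 y (Ici 0)
  /-- `y ∈ C([0,∞); D(A_lam))`, where `f = A y`, `g = A_lam y` and `c t = (η y_x)(t,1)`; moreover
  the equation `y_tt = A_lam y` holds for all `t ≥ 0`, and the boundary condition at `x = 1` for
  all `t > 0`. The summand `y_t(t,1)` is the value at `x = 1` of the derivative
  `y_t(t) ∈ H¹_{1/σ,0}(0,1)`. -/
  equation : ∃ (f g : ℝ → L2Sigma a b) (c : ℝ → ℝ),
    ContinuousOn f (Ici 0) ∧ ContinuousOn g (Ici 0) ∧
    (∀ t, 0 ≤ t → HasOpALam d lam (y t) (f t) (g t) (c t)) ∧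
    (∀ t, 0 ≤ t → dtt y t = g t) ∧
    (∀ t, 0 < t → val (derivWithin y (Ici 0) t) 1 + c t + β * val (y t) 1 = 0)
  init₀ : y 0 = y₀
  init₁ : dt y 0 = y₁

/-- The energy `E_y(t)`. -/
def energy (d : ℝ → ℝ) (lam β : ℝ) (y : ℝ → H1Sigma0 a b) (t : ℝ) : ℝ :=
  (1 / 2) * ((∫ x in (0 : ℝ)..1, ((dt y t) x ^ 2 / sigma a b x + eta a b x * dx (y t) x ^ 2
      - lam / (sigma a b x * d x) * val (y t) x ^ 2)) + β * val (y t) 1 ^ 2)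

end DegWave

end

/-! The multiplier is the solution of a stationary problem. An element `u` of H¹ vanishing at 0 is
determined by `v = u'` in L²(0,1), so everything is carried over to that Hilbert space. There the
potential and boundary energy is the quadratic form of a symmetric bilinear form B, and Hardy's
inequality makes B coercive with constant 1_ε · min η (`norm_sq_le_energyForm`). Integration by
parts (`inner_add_energyForm_eq`) turns the equation with its boundary condition into (y_tt, φ) +
B(y, φ) = -y_t(1) φ(1) for every φ.

Testing with φ = y_t gives the dissipation law E' = -y_t(1)². By Lax–Milgram there is a fixed w with
B(w, φ) = φ(1). Testing with φ = w and using symmetry produces B(y, w) = y(1), so the function G =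
y(1) (y_t, w) satisfies G' = y_t(1) (y_t, w) - y(1) y_t(1) w(1) - y(1)². Integrating isolates ∫
y(1)². The values of G at the endpoints are bounded by the nonincreasing energy. In the two mixed
terms Young's inequality leaves y_t(1)², which dissipation integrates to at most E(s), and δ times
the energy. This is `integral_sq_observation_le`; it remains to bound w by the coercivity and Hardy
constants and to compare coefficients. -/

namespace DegWave
open Filter Topology

/-! ### Degenerate coefficients and the singular weights 1/σ and 1/(σd) -/

/-- The properties of a degenerate coefficient that the energy estimates use. -/
structure PowerLower (g : ℝ → ℝ) (K : ℝ) : Prop where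
  cont : ContinuousOn g (Icc 0 1)
  pos : ∀ x ∈ Ioc (0 : ℝ) 1, 0 < g x
  exp_pos : 0 < K
  exp_lt : K < 2
  lower : ∀ x ∈ Ioc (0 : ℝ) 1, g 1 * x ^ K ≤ g x

/-- Since z g'(z) ≤ K g(z), the quotient g(z) / z^K is nonincreasing on (0,1]; compare its value at
`x` with that at 1. -/
theorem mul_rpow_le_of_isDegConst {g : ℝ → ℝ} {K : ℝ} (c1 : ContDiffOn ℝ 1 g (Ioc 0 1))
    (pos : ∀ x ∈ Ioc (0 : ℝ) 1, 0 < g x) (hK : IsDegConst g K) :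
    ∀ x ∈ Ioc (0 : ℝ) 1, g 1 * x ^ K ≤ g x := by
  intro x hx
  have hanti : AntitoneOn (fun z => g z * z ^ (-K)) (Icc x 1) := by
    have hsub : Icc x 1 ⊆ Ioc 0 1 := fun z hz => ⟨hx.1.trans_le hz.1, hz.2⟩
    have hd : ∀ z ∈ Ioo x 1, HasDerivAt (fun z => g z * z ^ (-K))
        (derivWithin g (Ioc 0 1) z * z ^ (-K) + g z * (-K * z ^ (-K - 1))) z := by
      intro z hz
      have hz0 : 0 < z := hx.1.trans hz.1
      have hn : Ioc (0 : ℝ) 1 ∈ 𝓝 z := Ioc_mem_nhds hz0 hz.2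
      have h1 : HasDerivAt g (derivWithin g (Ioc 0 1) z) z :=
        ((c1.differentiableOn (by norm_num) z ⟨hz0, hz.2.le⟩).hasDerivWithinAt).hasDerivAt hn
      exact h1.mul (Real.hasDerivAt_rpow_const (Or.inl hz0.ne'))
    apply antitoneOn_of_deriv_nonpos (convex_Icc x 1)
    · apply (c1.continuousOn.mono hsub).mul
      exact fun z hz => (Real.continuousAt_rpow_const _ _
        (Or.inl (hx.1.trans_le hz.1).ne')).continuousWithinAt
    · rw [interior_Icc]
      exact fun z hz => (hd z hz).differentiableAt.differentiableWithinAt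
    · rw [interior_Icc]
      intro z hz
      rw [(hd z hz).deriv]
      have hz0 : 0 < z := hx.1.trans hz.1
      have hzm : z ∈ Ioc (0 : ℝ) 1 := ⟨hz0, hz.2.le⟩
      have h2 : z * |derivWithin g (Ioc 0 1) z| / g z ≤ K := hK.1 ⟨z, hzm, rfl⟩
      rw [div_le_iff₀ (pos z hzm)] at h2
      have h3 : z ^ (-K) = z ^ (-K - 1) * z := by
        rw [← Real.rpow_add_one hz0.ne']; ring_nf
      rw [h3]
      have h4 : 0 < z ^ (-K - 1) := Real.rpow_pos_of_pos hz0 _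
      have h5 : z * derivWithin g (Ioc 0 1) z ≤ K * g z :=
        (mul_le_mul_of_nonneg_left (le_abs_self _) hz0.le).trans h2
      nlinarith
  have h := hanti (left_mem_Icc.2 hx.2) (right_mem_Icc.2 hx.2) hx.2
  simp only [Real.one_rpow, mul_one] at h
  rw [Real.rpow_neg hx.1.le, ← div_eq_mul_inv, le_div_iff₀ (Real.rpow_pos_of_pos hx.1 _)] at h
  exact h

theorem PowerLower.of_degenerate {g : ℝ → ℝ} {K : ℝ}
    (h : WeaklyDegenerate g K ∨ StronglyDegenerate g K) : PowerLower g K := by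
  rcases h with h | h
  · exact ⟨h.cont, h.pos, h.mem.1, h.mem.2.trans (by norm_num),
      mul_rpow_le_of_isDegConst h.c1 h.pos h.const⟩
  · exact ⟨h.c1.continuousOn, h.pos, zero_lt_one.trans_le h.mem.1, h.mem.2,
      mul_rpow_le_of_isDegConst (h.c1.mono Ioc_subset_Icc_self) h.pos h.const⟩

theorem eta_pos (a b : ℝ → ℝ) (x : ℝ) : 0 < eta a b x := Real.exp_pos _

theorem continuousOn_eta {a b : ℝ → ℝ} (h : IntegrableOn (fun x => b x / a x) (Ioo 0 1)) :
    ContinuousOn (eta a b) (Icc 0 1) := by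
  have h1 : IntegrableOn (fun x => b x / a x) (uIcc 0 1) := by
    rw [uIcc_of_le zero_le_one, integrableOn_Icc_iff_integrableOn_Ioo]; exact h
  have := intervalIntegral.continuousOn_primitive_interval' (a := (1 / 2 : ℝ))
    (h1.intervalIntegrable) (by rw [uIcc_of_le zero_le_one]; constructor <;> norm_num)
  rw [uIcc_of_le zero_le_one] at this
  exact this.rexp

theorem etaMin_pos {a b : ℝ → ℝ} (h : IntegrableOn (fun x => b x / a x) (Ioo 0 1)) :
    0 < etaMin a b := by
  obtain ⟨x, hx, he⟩ := (isCompact_Icc.image_of_continuousOn (continuousOn_eta h)).sInf_mem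
    ((nonempty_Icc.2 zero_le_one).image _)
  rw [etaMin, ← he]
  exact eta_pos a b x

theorem etaMin_le {a b : ℝ → ℝ} (h : IntegrableOn (fun x => b x / a x) (Ioo 0 1)) {x : ℝ}
    (hx : x ∈ Icc (0 : ℝ) 1) : etaMin a b ≤ eta a b x :=
  csInf_le (isCompact_Icc.image_of_continuousOn (continuousOn_eta h)).bddBelow ⟨x, hx, rfl⟩

theorem le_etaMax {a b : ℝ → ℝ} (h : IntegrableOn (fun x => b x / a x) (Ioo 0 1)) {x : ℝ}
    (hx : x ∈ Icc (0 : ℝ) 1) : eta a b x ≤ etaMax a b :=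
  le_csSup (isCompact_Icc.image_of_continuousOn (continuousOn_eta h)).bddAbove ⟨x, hx, rfl⟩

theorem etaMax_pos {a b : ℝ → ℝ} (h : IntegrableOn (fun x => b x / a x) (Ioo 0 1)) :
    0 < etaMax a b :=
  (eta_pos a b 0).trans_le (le_etaMax h ⟨le_rfl, zero_le_one⟩)

/-- A weight on `(0,1)` against which squares of `H¹` functions vanishing at `0` are integrable. -/
structure IsWeight (r : ℝ → ℝ) : Prop where
  cont : ContinuousOn r (Ioc 0 1)
  pos : ∀ x ∈ Ioc (0 : ℝ) 1, 0 < r x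
  int : Integrable (fun x => x * r x) vol01

theorem IsWeight.aesm {r : ℝ → ℝ} (h : IsWeight r) : AEStronglyMeasurable r vol01 :=
  (h.cont.mono Ioo_subset_Ioc_self).aestronglyMeasurable measurableSet_Ioo

/-- One power of x is gained from u(x)² ≤ x ‖u'‖², so only x^(1-p) has to be integrable at 0, which
is the condition p < 2. -/
theorem integrable_mul_of_le_rpow {r : ℝ → ℝ} {C p : ℝ} (hp : p < 2)
    (cont : ContinuousOn r (Ioc 0 1)) (pos : ∀ x ∈ Ioc (0 : ℝ) 1, 0 < r x)
    (hr : ∀ x ∈ Ioc (0 : ℝ) 1, r x ≤ C * x ^ (-p)) : IsWeight r := by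
  refine ⟨cont, pos, ?_⟩
  have h1 : IntegrableOn (fun x : ℝ => x ^ (1 - p)) (Ioo 0 1) := by
    rw [← integrableOn_Ioc_iff_integrableOn_Ioo,
      ← intervalIntegrable_iff_integrableOn_Ioc_of_le zero_le_one]
    exact intervalIntegral.intervalIntegrable_rpow' (by linarith)
  refine Integrable.mono' (h1.const_mul C) ?_ ?_
  · exact ((continuousOn_id.mul cont).mono Ioo_subset_Ioc_self).aestronglyMeasurable
      measurableSet_Ioo
  · refine (ae_restrict_iff' measurableSet_Ioo).2 (ae_of_all _ fun x hx => ?_)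
    have hx' := Ioo_subset_Ioc_self hx
    rw [Real.norm_of_nonneg (mul_pos hx.1 (pos x hx')).le, sub_eq_add_neg,
      Real.rpow_add hx.1, Real.rpow_one]
    calc x * r x ≤ x * (C * x ^ (-p)) := mul_le_mul_of_nonneg_left (hr x hx') hx.1.le
      _ = _ := by ring

section
variable {a b d : ℝ → ℝ} {Ka Kd : ℝ}

theorem sigma_pos (ha : PowerLower a Ka) {x : ℝ} (hx : x ∈ Ioc (0 : ℝ) 1) : 0 < sigma a b x :=
  div_pos (ha.pos x hx) (eta_pos a b x)

theorem continuousOn_sigma (ha : PowerLower a Ka)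
    (h : IntegrableOn (fun x => b x / a x) (Ioo 0 1)) : ContinuousOn (sigma a b) (Ioc 0 1) :=
  (ha.cont.mono Ioc_subset_Icc_self).div ((continuousOn_eta h).mono Ioc_subset_Icc_self)
    fun x _ => (eta_pos a b x).ne'

theorem one_div_le_rpow {g : ℝ → ℝ} {K x : ℝ} (hg : PowerLower g K) (hx : x ∈ Ioc (0 : ℝ) 1) :
    1 / g x ≤ 1 / g 1 * x ^ (-K) := by
  have h1 := hg.pos 1 ⟨zero_lt_one, le_rfl⟩
  have h2 := Real.rpow_pos_of_pos hx.1 K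
  rw [Real.rpow_neg hx.1.le, ← one_div, div_mul_div_comm, one_mul]
  exact one_div_le_one_div_of_le (mul_pos h1 h2) (hg.lower x hx)

theorem one_div_sigma_le (ha : PowerLower a Ka)
    (h : IntegrableOn (fun x => b x / a x) (Ioo 0 1)) {x : ℝ} (hx : x ∈ Ioc (0 : ℝ) 1) :
    1 / sigma a b x ≤ etaMax a b / a 1 * x ^ (-Ka) := by
  have h1 := one_div_le_rpow ha hx
  calc 1 / sigma a b x = eta a b x * (1 / a x) := by rw [sigma, one_div_div]; ring
    _ ≤ etaMax a b * (1 / a 1 * x ^ (-Ka)) :=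
      mul_le_mul (le_etaMax h (Ioc_subset_Icc_self hx)) h1
        (one_div_nonneg.2 (ha.pos x hx).le) (etaMax_pos h).le
    _ = _ := by ring

theorem isWeight_sigma (ha : PowerLower a Ka)
    (h : IntegrableOn (fun x => b x / a x) (Ioo 0 1)) : IsWeight (fun x => 1 / sigma a b x) :=
  integrable_mul_of_le_rpow ha.exp_lt
    (continuousOn_const.div (continuousOn_sigma ha h) fun _ hx => (sigma_pos ha hx).ne')
    (fun _ hx => one_div_pos.2 (sigma_pos ha hx)) (fun _ hx => one_div_sigma_le ha h hx)

theorem isWeight_sigma_mul (ha : PowerLower a Ka) (hd : PowerLower d Kd) (hK : Ka + Kd < 2)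
    (h : IntegrableOn (fun x => b x / a x) (Ioo 0 1)) :
    IsWeight (fun x => 1 / (sigma a b x * d x)) := by
  refine integrable_mul_of_le_rpow (C := etaMax a b / a 1 * (1 / d 1)) hK
    (continuousOn_const.div ((continuousOn_sigma ha h).mul (hd.cont.mono Ioc_subset_Icc_self))
      fun x hx => (mul_pos (sigma_pos ha hx) (hd.pos x hx)).ne')
    (fun x hx => one_div_pos.2 (mul_pos (sigma_pos ha hx) (hd.pos x hx))) (fun x hx => ?_)
  calc 1 / (sigma a b x * d x) = 1 / sigma a b x * (1 / d x) := by
        rw [div_mul_div_comm, one_mul]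
    _ ≤ (etaMax a b / a 1 * x ^ (-Ka)) * (1 / d 1 * x ^ (-Kd)) :=
      mul_le_mul (one_div_sigma_le ha h hx) (one_div_le_rpow hd hx)
        (one_div_nonneg.2 (hd.pos x hx).le)
        ((one_div_pos.2 (sigma_pos ha hx)).le.trans (one_div_sigma_le ha h hx))
    _ = _ := by rw [neg_add, Real.rpow_add hx.1]; ring

end
end DegWave

/-! ### Primitives of L² functions and the bilinear forms built from them -/

namespace DegWave
open Filter Topology
noncomputable section

theorem integral_zero_one_eq (f : ℝ → ℝ) : ∫ x in (0 : ℝ)..1, f x = ∫ x, f x ∂vol01 := by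
  rw [intervalIntegral.integral_of_le zero_le_one, integral_Ioc_eq_integral_Ioo]

theorem intervalIntegrable_zero_one_iff {f : ℝ → ℝ} :
    IntervalIntegrable f volume 0 1 ↔ Integrable f vol01 := by
  rw [intervalIntegrable_iff_integrableOn_Ioc_of_le zero_le_one,
    integrableOn_Ioc_iff_integrableOn_Ioo]; rfl

theorem ae_vol01_of_forall {p : ℝ → Prop} (h : ∀ x ∈ Ioc (0 : ℝ) 1, p x) : ∀ᵐ x ∂vol01, p x :=
  (ae_restrict_iff' measurableSet_Ioo).2 (ae_of_all _ fun x hx => h x (Ioo_subset_Ioc_self hx))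

theorem integral_vol01_mono {f g : ℝ → ℝ} (hf : Integrable f vol01) (hg : Integrable g vol01)
    (h : ∀ x ∈ Ioc (0 : ℝ) 1, f x ≤ g x) : ∫ x, f x ∂vol01 ≤ ∫ x, g x ∂vol01 :=
  integral_mono_ae hf hg (ae_vol01_of_forall h)

theorem integrable_sq_coe (v : Lp ℝ 2 vol01) : Integrable (fun x => v x ^ 2) vol01 :=
  (Lp.memLp v).integrable_sq

theorem norm_sq_eq (v : Lp ℝ 2 vol01) : ‖v‖ ^ 2 = ∫ x, v x ^ 2 ∂vol01 := by
  rw [← real_inner_self_eq_norm_sq, L2.inner_def]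
  exact integral_congr_ae (ae_of_all _ fun x => real_inner_self_eq_norm_sq _ |>.trans (sq_abs _))

theorem integrable_coe (v : Lp ℝ 2 vol01) : IntegrableOn (v : ℝ → ℝ) (Icc 0 1) := by
  rw [integrableOn_Icc_iff_integrableOn_Ioo]
  exact (Lp.memLp v).integrable (by norm_num)

theorem intervalIntegrable_coe (v : Lp ℝ 2 vol01) {x : ℝ} (hx : x ∈ Icc (0 : ℝ) 1) :
    IntervalIntegrable (v : ℝ → ℝ) volume 0 x := by
  rw [intervalIntegrable_iff_integrableOn_Ioc_of_le hx.1]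
  exact (integrable_coe v).mono_set fun z hz => ⟨hz.1.le, hz.2.trans hx.2⟩

/-- The primitive of an `L²` function that vanishes at `0`. -/
def prim (v : Lp ℝ 2 vol01) (x : ℝ) : ℝ := ∫ s in (0 : ℝ)..x, v s

theorem continuousOn_prim (v : Lp ℝ 2 vol01) : ContinuousOn (prim v) (Icc 0 1) := by
  have := intervalIntegral.continuousOn_primitive_interval' (a := (0 : ℝ))
    (intervalIntegrable_coe v (right_mem_Icc.2 zero_le_one)) left_mem_uIcc
  rwa [uIcc_of_le zero_le_one] at this

theorem aesm_prim (v : Lp ℝ 2 vol01) : AEStronglyMeasurable (prim v) vol01 :=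
  ((continuousOn_prim v).mono Ioo_subset_Icc_self).aestronglyMeasurable measurableSet_Ioo

theorem integral_congr_coe {v w : ℝ → ℝ} (h : v =ᵐ[vol01] w) {x : ℝ} (hx : x ∈ Icc (0 : ℝ) 1) :
    ∫ s in (0 : ℝ)..x, v s = ∫ s in (0 : ℝ)..x, w s := by
  rw [intervalIntegral.integral_of_le hx.1, intervalIntegral.integral_of_le hx.1,
    integral_Ioc_eq_integral_Ioo, integral_Ioc_eq_integral_Ioo]
  exact integral_congr_ae (ae_mono (Measure.restrict_mono (Ioo_subset_Ioo_right hx.2) le_rfl) h)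

theorem prim_add (v w : Lp ℝ 2 vol01) {x : ℝ} (hx : x ∈ Icc (0 : ℝ) 1) :
    prim (v + w) x = prim v x + prim w x := by
  rw [prim, prim, prim, ← intervalIntegral.integral_add (intervalIntegrable_coe v hx)
    (intervalIntegrable_coe w hx)]
  exact integral_congr_coe (Lp.coeFn_add v w) hx

theorem prim_smul (c : ℝ) (v : Lp ℝ 2 vol01) {x : ℝ} (hx : x ∈ Icc (0 : ℝ) 1) :
    prim (c • v) x = c * prim v x := by
  rw [prim, prim, ← intervalIntegral.integral_const_mul]
  exact integral_congr_coe (Lp.coeFn_smul c v) hx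

/-- Cauchy–Schwarz on (0, x). The absolute value inside the integral is needed for the domination in
Fubini's theorem in `integral_mul_prim_eq`. -/
theorem sq_integral_abs_le (v : Lp ℝ 2 vol01) {x : ℝ} (hx : x ∈ Icc (0 : ℝ) 1) :
    (∫ s in (0 : ℝ)..x, |v s|) ^ 2 ≤ x * ‖v‖ ^ 2 := by
  rcases hx.1.eq_or_lt with rfl | hx0
  · simp
  have h1 : IntervalIntegrable (fun s => |v s|) volume 0 x := (intervalIntegrable_coe v hx).abs
  have hsub : Ioc 0 x ⊆ Icc (0 : ℝ) 1 := fun z hz => ⟨hz.1.le, hz.2.trans hx.2⟩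
  have hsq : IntegrableOn (fun s => v s ^ 2) (Icc 0 1) := by
    rw [integrableOn_Icc_iff_integrableOn_Ioo]; exact integrable_sq_coe v
  have h2 : IntervalIntegrable (fun s => v s ^ 2) volume 0 x := by
    rw [intervalIntegrable_iff_integrableOn_Ioc_of_le hx.1]; exact hsq.mono_set hsub
  have h3 : ∫ s in (0 : ℝ)..x, v s ^ 2 ≤ ‖v‖ ^ 2 := by
    rw [norm_sq_eq, intervalIntegral.integral_of_le hx.1, ← integral_Icc_eq_integral_Ioo]
    exact setIntegral_mono_set hsq (ae_of_all _ fun s => sq_nonneg _) hsub.eventuallyLE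
  set A := ∫ s in (0 : ℝ)..x, |v s| with hA
  -- The variance of |v| about its mean A/x, multiplied by x² to avoid division; expanding it gives
  -- the inequality.
  have h4 : 0 ≤ ∫ s in (0 : ℝ)..x, (x * |v s| - A) ^ 2 :=
    intervalIntegral.integral_nonneg hx.1 fun s _ => sq_nonneg _
  have h5 : ∫ s in (0 : ℝ)..x, (x * |v s| - A) ^ 2
      = x ^ 2 * (∫ s in (0 : ℝ)..x, v s ^ 2) - 2 * x * A * A + x * A ^ 2 := by
    have : ∀ s, (x * |v s| - A) ^ 2 = x ^ 2 * v s ^ 2 - 2 * x * A * |v s| + A ^ 2 := fun s => by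
      rw [← sq_abs (v s)]; ring
    simp only [this]
    rw [intervalIntegral.integral_add ((h2.const_mul _).sub (h1.const_mul _))
      intervalIntegrable_const,
      intervalIntegral.integral_sub (h2.const_mul _) (h1.const_mul _),
      intervalIntegral.integral_const_mul, intervalIntegral.integral_const_mul,
      intervalIntegral.integral_const, ← hA, smul_eq_mul, sub_zero]
  have h6 : x * A ^ 2 ≤ x * (x * ‖v‖ ^ 2) := by nlinarith
  exact le_of_mul_le_mul_left h6 hx0

theorem prim_sq_le (v : Lp ℝ 2 vol01) {x : ℝ} (hx : x ∈ Icc (0 : ℝ) 1) :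
    prim v x ^ 2 ≤ x * ‖v‖ ^ 2 := by
  refine le_trans ?_ (sq_integral_abs_le v hx)
  have h : |prim v x| ≤ ∫ s in (0 : ℝ)..x, |v s| :=
    intervalIntegral.abs_integral_le_integral_abs hx.1
  rw [← sq_abs (prim v x)]
  exact pow_le_pow_left₀ (abs_nonneg _) h 2

theorem abs_prim_mul_prim_le (v w : Lp ℝ 2 vol01) {x : ℝ} (hx : x ∈ Icc (0 : ℝ) 1) :
    |prim v x * prim w x| ≤ x * (‖v‖ * ‖w‖) := by
  refine abs_le_of_sq_le_sq ?_ (mul_nonneg hx.1 (mul_nonneg (norm_nonneg _) (norm_nonneg _)))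
  calc (prim v x * prim w x) ^ 2 = prim v x ^ 2 * prim w x ^ 2 := by ring
    _ ≤ (x * ‖v‖ ^ 2) * (x * ‖w‖ ^ 2) :=
      mul_le_mul (prim_sq_le v hx) (prim_sq_le w hx) (sq_nonneg _)
        (mul_nonneg hx.1 (sq_nonneg _))
    _ = _ := by ring

/-- Evaluation at `1` of the primitive. -/
def evalOne : Lp ℝ 2 vol01 →L[ℝ] ℝ :=
  LinearMap.mkContinuous
    { toFun := fun v => prim v 1
      map_add' := fun v w => prim_add v w (right_mem_Icc.2 zero_le_one)
      map_smul' := fun c v => prim_smul c v (right_mem_Icc.2 zero_le_one) } 1 fun v => by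
    have := prim_sq_le v (right_mem_Icc.2 zero_le_one)
    rw [one_mul] at this ⊢
    exact abs_le_of_sq_le_sq this (norm_nonneg _)

theorem evalOne_apply (v : Lp ℝ 2 vol01) : evalOne v = prim v 1 := rfl

theorem evalOne_sq_le (v : Lp ℝ 2 vol01) : evalOne v ^ 2 ≤ ‖v‖ ^ 2 :=
  (prim_sq_le v (right_mem_Icc.2 zero_le_one)).trans_eq (one_mul _)

theorem IsWeight.norm_le {r : ℝ → ℝ} (hr : IsWeight r) (v w : Lp ℝ 2 vol01) {x : ℝ}
    (hx : x ∈ Ioc (0 : ℝ) 1) :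
    ‖prim v x * prim w x * r x‖ ≤ ‖v‖ * ‖w‖ * (x * r x) := by
  rw [norm_mul, Real.norm_of_nonneg (hr.pos x hx).le]
  calc ‖prim v x * prim w x‖ * r x ≤ x * (‖v‖ * ‖w‖) * r x :=
        mul_le_mul_of_nonneg_right (abs_prim_mul_prim_le v w (Ioc_subset_Icc_self hx))
          (hr.pos x hx).le
    _ = _ := by ring

theorem IsWeight.integrable {r : ℝ → ℝ} (hr : IsWeight r) (v w : Lp ℝ 2 vol01) :
    Integrable (fun x => prim v x * prim w x * r x) vol01 :=
  (hr.int.const_mul (‖v‖ * ‖w‖)).mono' (((aesm_prim v).mul (aesm_prim w)).mul hr.aesm)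
    (ae_vol01_of_forall fun _ hx => hr.norm_le v w hx)

/-- The bilinear form `∫ u v r` of the primitives. -/
def weightForm {r : ℝ → ℝ} (hr : IsWeight r) : Lp ℝ 2 vol01 →L[ℝ] Lp ℝ 2 vol01 →L[ℝ] ℝ :=
  LinearMap.mkContinuous₂
    (LinearMap.mk₂ ℝ (fun v w => ∫ x, prim v x * prim w x * r x ∂vol01)
      (fun v v' w => by
        rw [← integral_add (hr.integrable v w) (hr.integrable v' w)]
        exact integral_congr_ae (ae_vol01_of_forall fun x hx => by
          simp only [prim_add v v' (Ioc_subset_Icc_self hx)]; ring))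
      (fun c v w => by
        rw [smul_eq_mul, ← integral_const_mul]
        exact integral_congr_ae (ae_vol01_of_forall fun x hx => by
          simp only [prim_smul c v (Ioc_subset_Icc_self hx)]; ring))
      (fun v w w' => by
        rw [← integral_add (hr.integrable v w) (hr.integrable v w')]
        exact integral_congr_ae (ae_vol01_of_forall fun x hx => by
          simp only [prim_add w w' (Ioc_subset_Icc_self hx)]; ring))
      (fun c v w => by
        rw [smul_eq_mul, ← integral_const_mul]
        exact integral_congr_ae (ae_vol01_of_forall fun x hx => by
          simp only [prim_smul c w (Ioc_subset_Icc_self hx)]; ring)))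
    (∫ x, x * r x ∂vol01) fun v w => by
      rw [LinearMap.mk₂_apply]
      refine (norm_integral_le_of_norm_le (hr.int.const_mul (‖v‖ * ‖w‖))
        (ae_vol01_of_forall fun _ hx => hr.norm_le v w hx)).trans_eq ?_
      rw [integral_const_mul]; ring

theorem weightForm_apply {r : ℝ → ℝ} (hr : IsWeight r) (v w : Lp ℝ 2 vol01) :
    weightForm hr v w = ∫ x, prim v x * prim w x * r x ∂vol01 := rfl

theorem weightForm_self_le {r : ℝ → ℝ} (hr : IsWeight r) (v : Lp ℝ 2 vol01) :
    weightForm hr v v ≤ (∫ x, x * r x ∂vol01) * ‖v‖ ^ 2 := by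
  rw [weightForm_apply, ← integral_mul_const]
  refine integral_vol01_mono (hr.integrable v v) (hr.int.mul_const _) fun x hx => ?_
  calc _ ≤ _ := (le_abs_self _).trans (hr.norm_le v v hx)
    _ = _ := by ring

theorem weightForm_self_nonneg {r : ℝ → ℝ} (hr : IsWeight r) (v : Lp ℝ 2 vol01) :
    0 ≤ weightForm hr v v :=
  integral_nonneg_of_ae (ae_vol01_of_forall fun x hx =>
    mul_nonneg (mul_self_nonneg _) (hr.pos x hx).le)

theorem integrable_mul_coe {e : ℝ → ℝ} (he : ContinuousOn e (Icc 0 1)) (v w : Lp ℝ 2 vol01) :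
    Integrable (fun x => e x * (v x * w x)) vol01 := by
  obtain ⟨M, hM⟩ := isCompact_Icc.exists_bound_of_continuousOn he
  exact ((Lp.memLp v).integrable_mul (Lp.memLp w)).bdd_mul
    ((he.mono Ioo_subset_Icc_self).aestronglyMeasurable measurableSet_Ioo)
    (ae_vol01_of_forall fun x hx => hM x (Ioc_subset_Icc_self hx))

/-- The bilinear form `∫ e v w`, for a continuous coefficient `e`. -/
def coeffForm {e : ℝ → ℝ} (he : ContinuousOn e (Icc 0 1)) :
    Lp ℝ 2 vol01 →L[ℝ] Lp ℝ 2 vol01 →L[ℝ] ℝ :=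
  LinearMap.mkContinuous₂
    (LinearMap.mk₂ ℝ (fun v w => ∫ x, e x * (v x * w x) ∂vol01)
      (fun v v' w => by
        rw [← integral_add (integrable_mul_coe he v w) (integrable_mul_coe he v' w)]
        refine integral_congr_ae ?_
        filter_upwards [Lp.coeFn_add v v'] with x hx
        rw [hx, Pi.add_apply]; ring)
      (fun c v w => by
        rw [smul_eq_mul, ← integral_const_mul]
        refine integral_congr_ae ?_
        filter_upwards [Lp.coeFn_smul c v] with x hx
        rw [hx, Pi.smul_apply, smul_eq_mul]; ring)
      (fun v w w' => by
        rw [← integral_add (integrable_mul_coe he v w) (integrable_mul_coe he v w')]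
        refine integral_congr_ae ?_
        filter_upwards [Lp.coeFn_add w w'] with x hx
        rw [hx, Pi.add_apply]; ring)
      (fun c v w => by
        rw [smul_eq_mul, ← integral_const_mul]
        refine integral_congr_ae ?_
        filter_upwards [Lp.coeFn_smul c w] with x hx
        rw [hx, Pi.smul_apply, smul_eq_mul]; ring))
    (Classical.choose (isCompact_Icc.exists_bound_of_continuousOn he)) fun v w => by
      rw [LinearMap.mk₂_apply]
      have hM := Classical.choose_spec (isCompact_Icc.exists_bound_of_continuousOn he)
      set M := Classical.choose (isCompact_Icc.exists_bound_of_continuousOn he)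
      have hM0 : 0 ≤ M := (norm_nonneg _).trans (hM 0 (left_mem_Icc.2 zero_le_one))
      have hint : Integrable (fun x => |v x| * |w x|) vol01 :=
        (Lp.memLp v).abs.integrable_mul (Lp.memLp w).abs
      refine (norm_integral_le_of_norm_le (hint.const_mul M)
        (ae_vol01_of_forall fun x hx => ?_)).trans ?_
      · rw [norm_mul, norm_mul]
        exact mul_le_mul_of_nonneg_right (hM x (Ioc_subset_Icc_self hx)) (by positivity)
      · rw [integral_const_mul, mul_assoc]
        refine mul_le_mul_of_nonneg_left ?_ hM0
        -- Cauchy–Schwarz is applied to the lattice absolute values |v|, |w| in L², which have the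
        -- same norms as v, w.
        have h : ∫ x, |v x| * |w x| ∂vol01 = inner ℝ (|v|) (|w|) := by
          rw [L2.inner_def]
          refine integral_congr_ae ?_
          filter_upwards [Lp.coeFn_abs v, Lp.coeFn_abs w] with x h1 h2
          rw [h1, h2]; exact mul_comm _ _
        rw [h, ← norm_abs_eq_norm v, ← norm_abs_eq_norm w]
        exact real_inner_le_norm _ _

theorem coeffForm_apply {e : ℝ → ℝ} (he : ContinuousOn e (Icc 0 1)) (v w : Lp ℝ 2 vol01) :
    coeffForm he v w = ∫ x, e x * (v x * w x) ∂vol01 := rfl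

theorem mul_norm_sq_le_coeffForm {e : ℝ → ℝ} (he : ContinuousOn e (Icc 0 1)) {m : ℝ}
    (hm : ∀ x ∈ Icc (0 : ℝ) 1, m ≤ e x) (v : Lp ℝ 2 vol01) :
    m * ‖v‖ ^ 2 ≤ coeffForm he v v := by
  rw [norm_sq_eq, coeffForm_apply, ← integral_const_mul]
  refine integral_vol01_mono ((integrable_sq_coe v).const_mul m) (integrable_mul_coe he v v)
    fun x hx => ?_
  rw [← sq]
  exact mul_le_mul_of_nonneg_right (hm x (Ioc_subset_Icc_self hx)) (sq_nonneg _)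

end
end DegWave

/-! ### The abstract multiplier estimate -/

namespace DegWave
open scoped InnerProductSpace

section AbstractEstimate
variable {V L : Type*} [NormedAddCommGroup V] [NormedSpace ℝ V] [NormedAddCommGroup L]
  [InnerProductSpace ℝ L]

/-- Here `ev` is the trace at x = 1, `i` the embedding into the weighted space, `w` the stationary
multiplier and `q` the second time derivative. Only the bounds `k` on the trace and `D` on `i w`
enter the constants. -/
theorem integral_sq_observation_le (i : V →L[ℝ] L) (ev : V →L[ℝ] ℝ) (B : V →L[ℝ] V →L[ℝ] ℝ)
    (symm : ∀ u v, B u v = B v u) {k D : ℝ} (hk0 : 0 < k)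
    (hk : ∀ u, ev u ^ 2 ≤ k * B u u) {w : V} (hw : ∀ φ, B w φ = ev φ) (hwD : ‖i w‖ ≤ D)
    (hw0 : 0 ≤ ev w) (hw1 : ev w ≤ k) {y y' : ℝ → V} {q : ℝ → L}
    (hy : ∀ t, 0 < t → HasDerivAt y (y' t) t)
    (hv : ∀ t, 0 < t → HasDerivAt (fun r => i (y' r)) (q t) t)
    (hyc : ContinuousOn y' (Ioi 0))
    (heq : ∀ t, 0 < t → ∀ φ, ⟪q t, i φ⟫_ℝ + B (y t) φ = -ev (y' t) * ev φ)
    {E : ℝ → ℝ} (hE : ∀ t, 0 < t → E t = 1 / 2 * (‖i (y' t)‖ ^ 2 + B (y t) (y t)))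
    {s T δ : ℝ} (hs : 0 < s) (hsT : s < T) (hδ : 0 < δ) :
    0 ≤ E s ∧ 0 ≤ ∫ t in s..T, E t ∧
    ∫ t in s..T, ev (y t) ^ 2 ≤ (2 * (1 + D ^ 2 * k) + 1 / (2 * δ) * (1 + D ^ 2)) * E s
      + δ * (1 + k ^ 3) * ∫ t in s..T, E t := by
  have hpos : ∀ t ∈ Icc s T, 0 < t := fun t ht => hs.trans_le ht.1
  have hsub : Icc s T ⊆ Ioi 0 := hpos
  have hB0 : ∀ u, 0 ≤ B u u := fun u =>
    nonneg_of_mul_nonneg_right ((sq_nonneg _).trans (hk u)) hk0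
  have hE0 : ∀ t ∈ Icc s T, 0 ≤ E t := fun t ht => by
    rw [hE t (hpos t ht)]; have := hB0 (y t); positivity
  set F : ℝ → ℝ := fun t => 1 / 2 * (⟪i (y' t), i (y' t)⟫_ℝ + B (y t) (y t)) with hF
  have hFn : ∀ t, F t = 1 / 2 * (‖i (y' t)‖ ^ 2 + B (y t) (y t)) := fun t => by
    simp only [hF, real_inner_self_eq_norm_sq]
  have hFE : ∀ t ∈ Icc s T, F t = E t := fun t ht => by
    rw [hE t (hpos t ht), hFn]
  -- Dissipation: the weak equation is tested with y' itself.
  have hFd : ∀ t, 0 < t → HasDerivAt F (-ev (y' t) ^ 2) t := by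
    intro t ht
    have h1 := (hv t ht).inner ℝ (hv t ht)
    have h2 := (B.hasFDerivAt.comp_hasDerivAt t (hy t ht)).clm_apply (hy t ht)
    refine ((h1.add h2).const_mul (1 / 2)).congr_deriv ?_
    have h3 := heq t ht (y' t)
    simp only [Function.comp_apply]
    rw [real_inner_comm (q t) (i (y' t)), symm (y' t) (y t)]
    linarith
  set G : ℝ → ℝ := fun t => ev (y t) * ⟪i (y' t), i w⟫_ℝ with hG
  have hGd : ∀ t, 0 < t → HasDerivAt G
      (ev (y' t) * ⟪i (y' t), i w⟫_ℝ - ev (y t) * ev (y' t) * ev w - ev (y t) ^ 2) t := by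
    intro t ht
    have h1 := (hv t ht).inner ℝ (hasDerivAt_const t (i w))
    have h2 := ev.hasFDerivAt.comp_hasDerivAt t (hy t ht)
    refine (h2.mul h1).congr_deriv ?_
    -- By symmetry B(y, w) = B(w, y) = ev y, so this test creates the term ev(y)² to be estimated.
    have h3 := heq t ht w
    rw [symm, hw] at h3
    simp only [Function.comp_apply, inner_zero_right, zero_add]
    linear_combination ev (y t) * h3
  have hycon : ContinuousOn y (Ioi 0) := fun t ht => (hy t ht).continuousAt.continuousWithinAt
  have hc1 : ContinuousOn (fun t => ev (y t)) (Icc s T) :=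
    ev.continuous.comp_continuousOn (hycon.mono hsub)
  have hc2 : ContinuousOn (fun t => ev (y' t)) (Icc s T) :=
    ev.continuous.comp_continuousOn (hyc.mono hsub)
  have hc3 : ContinuousOn (fun t => ⟪i (y' t), i w⟫_ℝ) (Icc s T) :=
    (i.continuous.comp_continuousOn (hyc.mono hsub)).inner continuousOn_const
  have hFc : ContinuousOn F (Icc s T) := fun t ht =>
    (hFd t (hpos t ht)).continuousAt.continuousWithinAt
  have hint : ∀ {f : ℝ → ℝ}, ContinuousOn f (Icc s T) → IntervalIntegrable f volume s T :=
    fun hf => (by rwa [uIcc_of_le hsT.le] : ContinuousOn _ (uIcc s T)).intervalIntegrable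
  have hi1 : IntervalIntegrable (fun t => -ev (y' t) ^ 2) volume s T := hint (hc2.pow 2).neg
  have hi2 : IntervalIntegrable (fun t => ev (y' t) * ⟪i (y' t), i w⟫_ℝ
      - ev (y t) * ev (y' t) * ev w - ev (y t) ^ 2) volume s T :=
    hint (((hc2.mul hc3).sub ((hc1.mul hc2).mul (continuousOn_const (c := ev w)))).sub
      (hc1.pow 2))
  have hI1 : ∫ t in s..T, -ev (y' t) ^ 2 = F T - F s := by
    refine intervalIntegral.integral_eq_sub_of_hasDerivAt (fun t ht => hFd t (hpos t ?_)) hi1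
    rwa [uIcc_of_le hsT.le] at ht
  have hI2 : ∫ t in s..T, (ev (y' t) * ⟪i (y' t), i w⟫_ℝ - ev (y t) * ev (y' t) * ev w
      - ev (y t) ^ 2) = G T - G s := by
    refine intervalIntegral.integral_eq_sub_of_hasDerivAt (fun t ht => hGd t (hpos t ?_)) hi2
    rwa [uIcc_of_le hsT.le] at ht
  have hIE : ∫ t in s..T, E t = ∫ t in s..T, F t := by
    refine intervalIntegral.integral_congr fun t ht => (hFE t ?_).symm
    rwa [uIcc_of_le hsT.le] at ht
  have hFmono : F T ≤ F s := by
    have : 0 ≤ ∫ t in s..T, ev (y' t) ^ 2 :=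
      intervalIntegral.integral_nonneg hsT.le fun t _ => sq_nonneg _
    rw [intervalIntegral.integral_neg] at hI1
    linarith
  have hinner : ∀ t, |⟪i (y' t), i w⟫_ℝ| ≤ ‖i (y' t)‖ * D := fun t =>
    (abs_real_inner_le_norm _ _).trans (mul_le_mul_of_nonneg_left hwD (norm_nonneg _))
  -- |ev y| D ‖i y'‖ ≤ ½ (D² ev(y)² + ‖i y'‖²), followed by ev(y)² ≤ k B(y, y).
  have hGb : ∀ t, |G t| ≤ (1 + D ^ 2 * k) * F t := by
    intro t
    have h1 : |G t| ≤ |ev (y t)| * (‖i (y' t)‖ * D) := by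
      rw [hG, abs_mul]; exact mul_le_mul_of_nonneg_left (hinner t) (abs_nonneg _)
    have h2 := hk (y t)
    have h3 := sq_nonneg (|ev (y t)| * D - ‖i (y' t)‖)
    have h5 : ev (y t) ^ 2 * D ^ 2 ≤ k * B (y t) (y t) * D ^ 2 :=
      mul_le_mul_of_nonneg_right h2 (sq_nonneg _)
    have h6 : |ev (y t)| ^ 2 = ev (y t) ^ 2 := sq_abs _
    have h7 : 0 ≤ D ^ 2 * k * ‖i (y' t)‖ ^ 2 := by positivity
    have h8 := hB0 (y t)
    rw [hFn]
    nlinarith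
  -- The identity for G' solved for ev(y)², with Young's inequality in both mixed terms. The
  -- derivatives of G and F are kept as they stand, so that integration in t yields endpoint values.
  have hpt : ∀ t ∈ Icc s T, ev (y t) ^ 2 ≤
      -(ev (y' t) * ⟪i (y' t), i w⟫_ℝ - ev (y t) * ev (y' t) * ev w - ev (y t) ^ 2)
      + (-(1 / (2 * δ) * (1 + D ^ 2)) * (-ev (y' t) ^ 2) + δ * (1 + k ^ 3) * F t) := by
    intro t ht
    have young : ∀ p r : ℝ, p * r ≤ 1 / (2 * δ) * p ^ 2 + δ / 2 * r ^ 2 := by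
      intro p r
      have h := sq_nonneg (p - δ * r)
      have h' : 0 ≤ 1 / (2 * δ) * (p - δ * r) ^ 2 := by positivity
      have h'' : 1 / (2 * δ) * (p - δ * r) ^ 2
          = 1 / (2 * δ) * p ^ 2 + δ / 2 * r ^ 2 - p * r := by
        field_simp; ring
      linarith
    have h1 : ev (y' t) * ⟪i (y' t), i w⟫_ℝ
        ≤ 1 / (2 * δ) * (ev (y' t) ^ 2 * D ^ 2) + δ / 2 * ‖i (y' t)‖ ^ 2 := by
      calc ev (y' t) * ⟪i (y' t), i w⟫_ℝ ≤ |ev (y' t)| * (‖i (y' t)‖ * D) := by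
            refine (le_abs_self _).trans ?_
            rw [abs_mul]; exact mul_le_mul_of_nonneg_left (hinner t) (abs_nonneg _)
        _ = (|ev (y' t)| * D) * ‖i (y' t)‖ := by ring
        _ ≤ _ := (young _ _).trans_eq (by rw [mul_pow, sq_abs])
    have h2 := young (ev (y' t)) (-(ev (y t) * ev w))
    have h3 : ev (y t) ^ 2 * ev w ^ 2 ≤ k * B (y t) (y t) * k ^ 2 :=
      mul_le_mul (hk _) (pow_le_pow_left₀ hw0 hw1 2) (sq_nonneg _)
        (mul_nonneg hk0.le (hB0 _))
    have h5 : δ / 2 * (ev (y t) ^ 2 * ev w ^ 2) ≤ δ / 2 * (k * B (y t) (y t) * k ^ 2) :=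
      mul_le_mul_of_nonneg_left h3 (by positivity)
    -- These nonnegative terms complete ‖i y'‖² + k³ B(y, y) to (1 + k³) times twice the energy.
    have h6 : 0 ≤ δ * k ^ 3 * ‖i (y' t)‖ ^ 2 := by positivity
    have h7 : 0 ≤ δ * B (y t) (y t) := mul_nonneg hδ.le (hB0 _)
    rw [hFn]
    have h8 : (-(ev (y t) * ev w)) ^ 2 = ev (y t) ^ 2 * ev w ^ 2 := by ring
    rw [h8] at h2
    linarith
  refine ⟨hE0 s ⟨le_rfl, hsT.le⟩,
    intervalIntegral.integral_nonneg hsT.le hE0, ?_⟩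
  have hi3 : IntervalIntegrable (fun t => -(ev (y' t) * ⟪i (y' t), i w⟫_ℝ
      - ev (y t) * ev (y' t) * ev w - ev (y t) ^ 2)) volume s T := hi2.neg
  have hmain := intervalIntegral.integral_mono_on hsT.le (hint (hc1.pow 2))
    (hi3.add ((hi1.const_mul _).add ((hint hFc).const_mul _))) hpt
  rw [intervalIntegral.integral_add hi3 ((hi1.const_mul _).add ((hint hFc).const_mul _)),
    intervalIntegral.integral_add (hi1.const_mul _) ((hint hFc).const_mul _),
    intervalIntegral.integral_neg, hI2, intervalIntegral.integral_const_mul, hI1,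
    intervalIntegral.integral_const_mul] at hmain
  rw [hIE, ← hFE s ⟨le_rfl, hsT.le⟩]
  have hT0 : 0 ≤ F T := (hE0 T ⟨hsT.le, le_rfl⟩).trans_eq (hFE T ⟨hsT.le, le_rfl⟩).symm
  have hGs := (le_abs_self _).trans (hGb s)
  have hGT := (neg_le_abs _).trans (hGb T)
  -- Monotonicity replaces the endpoint bound at T by that at s, whence the factor 2; the
  -- contribution -F(T) of the dissipation integral is dropped.
  have h1 : (1 + D ^ 2 * k) * F T ≤ (1 + D ^ 2 * k) * F s :=
    mul_le_mul_of_nonneg_left hFmono (by positivity)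
  simp only [Pi.pow_apply] at hmain
  have h2 : 0 ≤ 1 / (2 * δ) * (1 + D ^ 2) * F T := by positivity
  linarith

end AbstractEstimate
end DegWave

/-! ### The space L²_{1/σ} and integration by parts -/

namespace DegWave
open Filter Topology
open scoped InnerProductSpace
noncomputable section

section Weighted
variable {a b : ℝ → ℝ} {Ka : ℝ}

theorem aemeasurable_density (hw : IsWeight fun x => 1 / sigma a b x) :
    AEMeasurable (fun x => ENNReal.ofReal (1 / sigma a b x)) vol01 :=
  hw.aesm.aemeasurable.ennreal_ofReal

theorem vol01_ac (hw : IsWeight fun x => 1 / sigma a b x) : vol01 ≪ muSigma a b :=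
  withDensity_absolutelyContinuous' (aemeasurable_density hw)
    (ae_vol01_of_forall fun x hx => (ENNReal.ofReal_pos.2 (hw.pos x hx)).ne')

theorem ae_muSigma_iff (hw : IsWeight fun x => 1 / sigma a b x) {p : ℝ → Prop} :
    (∀ᵐ x ∂muSigma a b, p x) ↔ ∀ᵐ x ∂vol01, p x :=
  ⟨fun h => (vol01_ac hw).ae_le h, fun h => (withDensity_absolutelyContinuous _ _).ae_le h⟩

theorem integral_muSigma (hw : IsWeight fun x => 1 / sigma a b x) (f : ℝ → ℝ) :
    ∫ x, f x ∂muSigma a b = ∫ x, f x * (1 / sigma a b x) ∂vol01 := by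
  rw [muSigma, integral_withDensity_eq_integral_toReal_smul₀ (aemeasurable_density hw)
    (ae_of_all _ fun _ => ENNReal.ofReal_lt_top)]
  refine integral_congr_ae (ae_vol01_of_forall fun x hx => ?_)
  simp only [ENNReal.toReal_ofReal (hw.pos x hx).le, smul_eq_mul]
  exact mul_comm _ _

theorem integrable_muSigma_iff (hw : IsWeight fun x => 1 / sigma a b x) {f : ℝ → ℝ} :
    Integrable f (muSigma a b) ↔ Integrable (fun x => f x * (1 / sigma a b x)) vol01 := by
  rw [muSigma, integrable_withDensity_iff_integrable_smul₀' (aemeasurable_density hw)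
    (ae_of_all _ fun _ => ENNReal.ofReal_lt_top)]
  refine integrable_congr (ae_vol01_of_forall fun x hx => ?_)
  simp only [ENNReal.toReal_ofReal (hw.pos x hx).le, smul_eq_mul]
  exact mul_comm _ _

theorem inner_L2Sigma (hw : IsWeight fun x => 1 / sigma a b x) (f g : L2Sigma a b) :
    ⟪f, g⟫_ℝ = ∫ x, f x * g x * (1 / sigma a b x) ∂vol01 := by
  rw [L2.inner_def, ← integral_muSigma hw]
  exact integral_congr_ae (ae_of_all _ fun x => mul_comm _ _)

theorem integrable_L2Sigma_mul (hw : IsWeight fun x => 1 / sigma a b x) (f g : L2Sigma a b) :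
    Integrable (fun x => f x * g x * (1 / sigma a b x)) vol01 :=
  (integrable_muSigma_iff hw).1 ((Lp.memLp f).integrable_mul (Lp.memLp g))

theorem memLp_prim (hw : IsWeight fun x => 1 / sigma a b x) (v : Lp ℝ 2 vol01) :
    MemLp (prim v) 2 (muSigma a b) := by
  have hm : AEStronglyMeasurable (prim v) (muSigma a b) :=
    (aesm_prim v).mono_ac (withDensity_absolutelyContinuous _ _)
  rw [memLp_two_iff_integrable_sq hm, integrable_muSigma_iff hw]
  simpa only [sq] using hw.integrable v v

theorem inner_toLp_prim (hw : IsWeight fun x => 1 / sigma a b x) (f : L2Sigma a b)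
    (v : Lp ℝ 2 vol01) :
    ⟪f, (memLp_prim hw v).toLp⟫_ℝ = ∫ x, f x * prim v x * (1 / sigma a b x) ∂vol01 := by
  rw [inner_L2Sigma hw]
  refine integral_congr_ae ?_
  filter_upwards [(ae_muSigma_iff hw).1 (memLp_prim hw v).coeFn_toLp] with x hx
  rw [hx]

theorem norm_toLp_prim_sq (hw : IsWeight fun x => 1 / sigma a b x) (v : Lp ℝ 2 vol01) :
    ‖(memLp_prim hw v).toLp‖ ^ 2 = weightForm hw v v := by
  rw [← real_inner_self_eq_norm_sq, inner_toLp_prim hw, weightForm_apply]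
  refine integral_congr_ae ?_
  filter_upwards [(ae_muSigma_iff hw).1 (memLp_prim hw v).coeFn_toLp] with x hx
  rw [hx]

/-- The operator that sends `v ∈ L²(0,1)` to its primitive, as an element of `L²_{1/σ}`. -/
def primL2 (hw : IsWeight fun x => 1 / sigma a b x) : Lp ℝ 2 vol01 →L[ℝ] L2Sigma a b :=
  LinearMap.mkContinuous
    { toFun := fun v => (memLp_prim hw v).toLp
      map_add' := fun v w => by
        rw [← MemLp.toLp_add]
        exact MemLp.toLp_congr _ _ ((ae_muSigma_iff hw).2 (ae_vol01_of_forall fun x hx =>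
          prim_add v w (Ioc_subset_Icc_self hx)))
      map_smul' := fun c v => by
        rw [RingHom.id_apply, ← MemLp.toLp_const_smul]
        exact MemLp.toLp_congr _ _ ((ae_muSigma_iff hw).2 (ae_vol01_of_forall fun x hx =>
          prim_smul c v (Ioc_subset_Icc_self hx))) }
    (Real.sqrt (∫ x, x * (1 / sigma a b x) ∂vol01)) fun v => by
      have h := (norm_toLp_prim_sq hw v).trans_le (weightForm_self_le hw v)
      have h0 : 0 ≤ ∫ x, x * (1 / sigma a b x) ∂vol01 :=
        integral_nonneg_of_ae (ae_vol01_of_forall fun x hx => mul_nonneg hx.1.le (hw.pos x hx).le)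
      refine abs_le_of_sq_le_sq ?_ (mul_nonneg (Real.sqrt_nonneg _) (norm_nonneg _))
        |>.trans' (le_abs_self _)
      rw [mul_pow, Real.sq_sqrt h0]
      exact h

theorem primL2_apply (hw : IsWeight fun x => 1 / sigma a b x) (v : Lp ℝ 2 vol01) :
    primL2 hw v = (memLp_prim hw v).toLp := rfl

/-- Together with `ofDeriv`, this identifies H¹_{1/σ,0} with L²(0,1) through u ↦ u'. -/
theorem toL2_eq_primL2 (hw : IsWeight fun x => 1 / sigma a b x) (u : H1Sigma0 a b) :
    toL2 u = primL2 hw u.val.snd := by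
  apply Lp.ext
  have h1 := (ae_muSigma_iff hw).1 u.property
  have h2 := (ae_muSigma_iff hw).1 (memLp_prim hw u.val.snd).coeFn_toLp
  refine (ae_muSigma_iff hw).2 ?_
  filter_upwards [h1, h2, ae_restrict_mem measurableSet_Ioo] with x h3 h4 h5
  rw [primL2_apply, h4]
  exact h3 h5

/-- The element of `H¹_{1/σ,0}` with derivative `v`. -/
def ofDeriv (hw : IsWeight fun x => 1 / sigma a b x) (v : Lp ℝ 2 vol01) : H1Sigma0 a b :=
  ⟨WithLp.toLp 2 (primL2 hw v, v), by
    filter_upwards [(memLp_prim hw v).coeFn_toLp] with x hx _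
    exact hx⟩

/-- Integration by parts in the form of Fubini's theorem on the triangle x < s, so that no boundary
term at the degenerate point 0 has to be examined. -/
theorem integral_mul_prim_eq (hw : IsWeight fun x => 1 / sigma a b x) (f : L2Sigma a b)
    (v : Lp ℝ 2 vol01) :
    ∫ x, f x * prim v x * (1 / sigma a b x) ∂vol01
      = ∫ x, v x * (∫ s in x..1, f s / sigma a b s) ∂vol01 := by
  set F : ℝ → ℝ := fun s => f s / sigma a b s with hF
  have hFm : AEStronglyMeasurable F vol01 := by
    have := ((Lp.aestronglyMeasurable f).mono_ac (vol01_ac hw)).mul hw.aesm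
    exact this.congr (ae_of_all _ fun s => (div_eq_mul_one_div _ _).symm)
  set k : ℝ → ℝ → ℝ := fun s x => (Iio s).indicator (fun x => F s * v x) x with hk
  have hvm := Lp.aestronglyMeasurable v
  have hkm : AEStronglyMeasurable (Function.uncurry k) (vol01.prod vol01) := by
    have h1 : AEStronglyMeasurable (fun p : ℝ × ℝ => F p.1 * v p.2) (vol01.prod vol01) :=
      hFm.comp_fst.mul hvm.comp_snd
    have h2 := h1.indicator (measurableSet_lt measurable_snd measurable_fst)
    exact h2
  have hsets : ∀ s ∈ Ioo (0 : ℝ) 1, Ioo 0 1 ∩ Iio s = Ioo 0 s := fun s hs => by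
    ext x; simp only [mem_inter_iff, mem_Ioo, mem_Iio]
    exact ⟨fun h => ⟨h.1.1, h.2⟩, fun h => ⟨⟨h.1, h.2.trans hs.2⟩, h.2⟩⟩
  have hki : Integrable (Function.uncurry k) (vol01.prod vol01) := by
    rw [integrable_prod_iff hkm]
    constructor
    · refine ae_of_all _ fun s => ?_
      exact (((Lp.memLp v).integrable (by norm_num)).const_mul (F s)).indicator measurableSet_Iio
    -- The inner integral is |f| ∫₀ˢ|v| / σ; the arithmetic–geometric mean inequality and (∫₀ˢ|v|)²
    -- ≤ s ‖v‖² bound it by this function.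
    · have hb : Integrable (fun s => 1 / 2 * (f s * f s * (1 / sigma a b s)
          + ‖v‖ ^ 2 * (s * (1 / sigma a b s)))) vol01 :=
        ((integrable_L2Sigma_mul hw f f).add (hw.int.const_mul _)).const_mul _
      refine hb.mono' hkm.norm.integral_prod_right' ?_
      filter_upwards [ae_restrict_mem measurableSet_Ioo] with s hs
      have hs' := Ioo_subset_Ioc_self hs
      have hs'' := Ioo_subset_Icc_self hs
      have h1 : ∫ x, ‖Function.uncurry k (s, x)‖ ∂vol01
          = |F s| * ∫ x in (0 : ℝ)..s, |v x| := by
        simp only [Function.uncurry, hk, norm_indicator_eq_indicator_norm, norm_mul]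
        rw [setIntegral_indicator measurableSet_Iio, hsets s hs, integral_const_mul,
          intervalIntegral.integral_of_le hs.1.le, integral_Ioc_eq_integral_Ioo]
        rfl
      have h2 := sq_integral_abs_le v hs''
      have h3 := hw.pos s hs'
      rw [h1, Real.norm_of_nonneg (mul_nonneg (abs_nonneg _)
        (intervalIntegral.integral_nonneg hs.1.le fun _ _ => abs_nonneg _))]
      have h4 : |F s| = |f s| * (1 / sigma a b s) := by
        rw [← abs_of_pos h3, ← abs_mul, ← div_eq_mul_one_div]
      have h5 : |f s| * (∫ x in (0 : ℝ)..s, |v x|) ≤ 1 / 2 * (f s * f s + s * ‖v‖ ^ 2) := by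
        nlinarith [sq_nonneg (|f s| - ∫ x in (0 : ℝ)..s, |v x|), abs_mul_abs_self (f s)]
      calc |F s| * (∫ x in (0 : ℝ)..s, |v x|)
          = |f s| * (∫ x in (0 : ℝ)..s, |v x|) * (1 / sigma a b s) := by rw [h4]; ring
        _ ≤ 1 / 2 * (f s * f s + s * ‖v‖ ^ 2) * (1 / sigma a b s) :=
          mul_le_mul_of_nonneg_right h5 h3.le
        _ = _ := by ring
  have hswap := integral_integral_swap hki
  have hL : ∫ s, ∫ x, k s x ∂vol01 ∂vol01
      = ∫ x, f x * prim v x * (1 / sigma a b x) ∂vol01 := by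
    refine integral_congr_ae ?_
    filter_upwards [ae_restrict_mem measurableSet_Ioo] with s hs
    simp only [hk]
    rw [setIntegral_indicator measurableSet_Iio, hsets s hs, integral_const_mul, prim,
      intervalIntegral.integral_of_le hs.1.le, integral_Ioc_eq_integral_Ioo, hF]
    ring
  have hR : ∫ x, ∫ s, k s x ∂vol01 ∂vol01 = ∫ x, v x * (∫ s in x..1, F s) ∂vol01 := by
    refine integral_congr_ae ?_
    filter_upwards [ae_restrict_mem measurableSet_Ioo] with x hx
    have h1 : ∀ s, k s x = (Ioi x).indicator (fun s => v x * F s) s := fun s => by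
      simp only [hk, indicator, mem_Iio, mem_Ioi, mul_comm]
    have h2 : Ioo (0 : ℝ) 1 ∩ Ioi x = Ioo x 1 := by
      ext s; simp only [mem_inter_iff, mem_Ioo, mem_Ioi]
      exact ⟨fun h => ⟨h.2, h.1.2⟩, fun h => ⟨⟨hx.1.trans h.1, h.2⟩, h.1⟩⟩
    simp only [h1]
    rw [setIntegral_indicator measurableSet_Ioi, h2, integral_const_mul,
      intervalIntegral.integral_of_le hx.2.le, integral_Ioc_eq_integral_Ioo]
  rw [← hL, hswap, hR]

/-- The a.e. formula for η u' is multiplied by `v` and integrated; Fubini's theorem rewrites the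
double integral, and `c` appears with ∫ v, the trace at 1. -/
theorem inner_eq_of_hasOpA (hw : IsWeight fun x => 1 / sigma a b x)
    (he : ContinuousOn (eta a b) (Icc 0 1)) {u : H1Sigma0 a b} {f : L2Sigma a b} {c : ℝ}
    (h : HasOpA u f c) (v : Lp ℝ 2 vol01) :
    ∫ x, f x * prim v x * (1 / sigma a b x) ∂vol01
      = c * evalOne v - coeffForm he u.val.snd v := by
  rw [integral_mul_prim_eq hw, evalOne_apply, prim, integral_zero_one_eq, coeffForm_apply,
    ← integral_const_mul, ← integral_sub (((Lp.memLp v).integrable (by norm_num)).const_mul c)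
      (integrable_mul_coe he _ _)]
  refine integral_congr_ae ?_
  filter_upwards [h] with x hx
  have hx' : eta a b x * u.val.snd x = c - ∫ s in x..1, f s / sigma a b s := hx
  linear_combination v x * hx'

end Weighted
end
end DegWave

/-! ### Hardy constants, coercivity of the energy form, and the weak equation -/

namespace DegWave
open Filter Topology
open scoped InnerProductSpace
noncomputable section

/-- An infimum of admissible constants is itself admissible. Nonemptiness matters, since the infimum
of the empty set is 0 by convention. -/
theorem le_sInf_mul {S : Set ℝ} (hS : S.Nonempty) {X N : ℝ} (hN : 0 ≤ N)
    (h : ∀ C ∈ S, X ≤ C * N) : X ≤ sInf S * N := by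
  rcases hN.eq_or_lt with rfl | hN
  · obtain ⟨C, hC⟩ := hS
    simpa using h C hC
  · rw [← div_le_iff₀ hN]
    exact le_csInf hS fun C hC => (div_le_iff₀ hN).2 (h C hC)

section Hardy
variable {a b d : ℝ → ℝ}

theorem hardyTilde_nonneg : 0 ≤ hardyTilde a b := Real.sInf_nonneg fun _ h => h.1

theorem val_sq_mul_eq (u : H1Sigma0 a b) (r : ℝ → ℝ) :
    (fun x => val u x ^ 2 / r x) = fun x => prim u.val.snd x * prim u.val.snd x * (1 / r x) := by
  funext x
  rw [← sq, mul_one_div]; rfl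

theorem weightForm_le_hardyTilde (hw : IsWeight fun x => 1 / sigma a b x) (v : Lp ℝ 2 vol01) :
    weightForm hw v v ≤ hardyTilde a b * ‖v‖ ^ 2 := by
  refine le_sInf_mul ?_ (sq_nonneg _) fun C hC => ?_
  · refine ⟨∫ x, x * (1 / sigma a b x) ∂vol01, integral_nonneg_of_ae (ae_vol01_of_forall
      fun x hx => mul_nonneg hx.1.le (hw.pos x hx).le), fun u => ⟨?_, ?_⟩⟩
    · rw [intervalIntegrable_zero_one_iff, val_sq_mul_eq]
      exact hw.integrable _ _
    · rw [integral_zero_one_eq, integral_zero_one_eq, val_sq_mul_eq]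
      exact (weightForm_self_le hw u.val.snd).trans_eq (by rw [norm_sq_eq]; rfl)
  · have h := (hC.2 (ofDeriv hw v)).2
    rw [integral_zero_one_eq, integral_zero_one_eq, val_sq_mul_eq] at h
    rw [norm_sq_eq]
    exact h

theorem weightForm_le_hardy (hw : IsWeight fun x => 1 / sigma a b x)
    (hwd : IsWeight fun x => 1 / (sigma a b x * d x)) (he : ContinuousOn (eta a b) (Icc 0 1))
    {m : ℝ} (hm : 0 < m) (hme : ∀ x ∈ Icc (0 : ℝ) 1, m ≤ eta a b x) (v : Lp ℝ 2 vol01) :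
    weightForm hwd v v ≤ hardy a b d * coeffForm he v v := by
  have hI : 0 ≤ ∫ x, x * (1 / (sigma a b x * d x)) ∂vol01 :=
    integral_nonneg_of_ae (ae_vol01_of_forall fun x hx => mul_nonneg hx.1.le (hwd.pos x hx).le)
  have hco : ∀ v : Lp ℝ 2 vol01, ∫ x, eta a b x * v x ^ 2 ∂vol01 = coeffForm he v v := fun v => by
    simp only [coeffForm_apply, sq]
  refine le_sInf_mul ?_
    ((mul_nonneg hm.le (sq_nonneg _)).trans (mul_norm_sq_le_coeffForm he hme v)) fun C hC => ?_
  · refine ⟨(∫ x, x * (1 / (sigma a b x * d x)) ∂vol01) / m, div_nonneg hI hm.le,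
      fun u => ⟨?_, ?_⟩⟩
    · rw [intervalIntegrable_zero_one_iff, val_sq_mul_eq u fun x => sigma a b x * d x]
      exact hwd.integrable _ _
    · rw [integral_zero_one_eq, integral_zero_one_eq,
        val_sq_mul_eq u fun x => sigma a b x * d x]
      refine (weightForm_self_le hwd u.val.snd).trans ?_
      have h1 := mul_norm_sq_le_coeffForm he hme u.val.snd
      have h2 : ∫ x, eta a b x * dx u x ^ 2 ∂vol01 = coeffForm he u.val.snd u.val.snd :=
        hco u.val.snd
      rw [h2, div_mul_eq_mul_div, mul_div_assoc]
      refine mul_le_mul_of_nonneg_left ?_ hI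
      rwa [le_div_iff₀ hm, mul_comm]
  · have h := (hC.2 (ofDeriv hw v)).2
    rw [integral_zero_one_eq, integral_zero_one_eq,
      val_sq_mul_eq _ fun x => sigma a b x * d x] at h
    rw [← hco]
    exact h

theorem oneEps_mem {lam : ℝ} (h : lam < 1 / hardy a b d) :
    0 < oneEps a b d lam ∧ oneEps a b d lam ≤ 1 := by
  unfold oneEps
  split_ifs with hl
  · exact ⟨zero_lt_one, le_rfl⟩
  · push Not at hl
    -- For λ > 0 the assumption λ < 1/C_HP excludes C_HP = 0, where the quotient would be 0 by
    -- convention.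
    have hpos : 0 < hardy a b d := one_div_pos.1 (hl.trans h)
    rw [lt_div_iff₀ hpos] at h
    exact ⟨sub_pos.2 h, sub_le_self _ (mul_pos hl hpos).le⟩

theorem cLam_sq {lam : ℝ} (h : lam < 1 / hardy a b d) (hm : 0 < etaMin a b) :
    cLam a b d lam ^ 2 = 1 / (oneEps a b d lam * etaMin a b) := by
  have h1 := (oneEps_mem h).1
  unfold cLam oneEps at *
  split_ifs with hl
  · rw [div_pow, Real.sq_sqrt hm.le, one_pow, one_mul]
  · rw [if_neg hl] at h1
    rw [div_pow, Real.sq_sqrt (mul_pos h1 hm).le, one_pow]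

/-- The bilinear form `∫ η u' v' - lam ∫ u v / (σ d) + β u(1) v(1)`, in terms of `u'` and `v'`. -/
def energyForm (hwd : IsWeight fun x => 1 / (sigma a b x * d x))
    (he : ContinuousOn (eta a b) (Icc 0 1)) (lam β : ℝ) :
    Lp ℝ 2 vol01 →L[ℝ] Lp ℝ 2 vol01 →L[ℝ] ℝ :=
  coeffForm he - lam • weightForm hwd + β • evalOne.smulRight evalOne

theorem energyForm_apply (hwd : IsWeight fun x => 1 / (sigma a b x * d x))
    (he : ContinuousOn (eta a b) (Icc 0 1)) (lam β : ℝ) (v w : Lp ℝ 2 vol01) :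
    energyForm hwd he lam β v w
      = coeffForm he v w - lam * weightForm hwd v w + β * (evalOne v * evalOne w) := rfl

theorem energyForm_symm (hwd : IsWeight fun x => 1 / (sigma a b x * d x))
    (he : ContinuousOn (eta a b) (Icc 0 1)) (lam β : ℝ) (v w : Lp ℝ 2 vol01) :
    energyForm hwd he lam β v w = energyForm hwd he lam β w v := by
  simp only [energyForm_apply, coeffForm_apply, weightForm_apply, mul_comm (v _),
    mul_comm (prim v _), mul_comm (evalOne v)]

/-- For λ ≤ 0 the potential term has a favourable sign. For λ > 0 Hardy's inequality absorbs it into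
the fraction λ C_HP = 1 - ε of ∫ η (u')², and the fraction ε remains. -/
theorem norm_sq_le_energyForm (hw : IsWeight fun x => 1 / sigma a b x)
    (hwd : IsWeight fun x => 1 / (sigma a b x * d x)) (he : ContinuousOn (eta a b) (Icc 0 1))
    (hm : 0 < etaMin a b) (hme : ∀ x ∈ Icc (0 : ℝ) 1, etaMin a b ≤ eta a b x) {lam β : ℝ}
    (hβ : 0 ≤ β) (h : lam < 1 / hardy a b d) (v : Lp ℝ 2 vol01) :
    oneEps a b d lam * etaMin a b * ‖v‖ ^ 2 ≤ energyForm hwd he lam β v v := by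
  have h1 := mul_norm_sq_le_coeffForm he hme v
  have h2 : 0 ≤ β * (evalOne v * evalOne v) := mul_nonneg hβ (mul_self_nonneg _)
  rw [energyForm_apply, mul_assoc]
  refine (mul_le_mul_of_nonneg_left h1 (oneEps_mem h).1.le).trans ?_
  unfold oneEps
  split_ifs with hl
  · have := mul_nonneg (neg_nonneg.2 hl) (weightForm_self_nonneg hwd v)
    linarith
  · have := mul_le_mul_of_nonneg_left (weightForm_le_hardy hw hwd he hm hme v) (not_le.1 hl).le
    linarith

end Hardy

/-- Lax–Milgram, used to produce the multiplier. -/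
theorem exists_bilin_eq {V : Type*} [NormedAddCommGroup V] [InnerProductSpace ℝ V]
    [CompleteSpace V] {B : V →L[ℝ] V →L[ℝ] ℝ} (hB : IsCoercive B) (l : V →L[ℝ] ℝ) :
    ∃ w, ∀ φ, B w φ = l φ := by
  refine ⟨hB.continuousLinearEquivOfBilin.symm ((InnerProductSpace.toDual ℝ V).symm l),
    fun φ => ?_⟩
  rw [← hB.continuousLinearEquivOfBilin_apply, ContinuousLinearEquiv.apply_symm_apply,
    InnerProductSpace.toDual_symm_apply]

section Solution
variable {a b d : ℝ → ℝ} {lam β : ℝ}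

/-- The embedding of `H¹_{1/σ,0}` into `L²_{1/σ}`. -/
def toL2L (a b : ℝ → ℝ) : H1Sigma0 a b →L[ℝ] L2Sigma a b :=
  (WithLp.fstL 2 ℝ (L2Sigma a b) (Lp ℝ 2 vol01)).comp (H1Sigma0 a b).subtypeL

/-- The weak derivative as a continuous linear map on `H¹_{1/σ,0}`. -/
def dxL (a b : ℝ → ℝ) : H1Sigma0 a b →L[ℝ] Lp ℝ 2 vol01 :=
  (WithLp.sndL 2 ℝ (L2Sigma a b) (Lp ℝ 2 vol01)).comp (H1Sigma0 a b).subtypeL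

theorem dxL_apply (u : H1Sigma0 a b) : dxL a b u = u.val.snd := rfl

/-- Weak form of A_λ u = g. The boundary condition at 1 later turns the factor c + β u(1) into
-y_t(1). -/
theorem inner_add_energyForm_eq (hw : IsWeight fun x => 1 / sigma a b x)
    (hwd : IsWeight fun x => 1 / (sigma a b x * d x)) (he : ContinuousOn (eta a b) (Icc 0 1))
    {u : H1Sigma0 a b} {f g : L2Sigma a b} {c : ℝ} (h : HasOpALam d lam u f g c)
    (v : Lp ℝ 2 vol01) :
    ⟪g, primL2 hw v⟫_ℝ + energyForm hwd he lam β (dxL a b u) v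
      = (c + β * evalOne (dxL a b u)) * evalOne v := by
  have hi : Integrable (fun x => f x * prim v x * (1 / sigma a b x)) vol01 := by
    refine (integrable_L2Sigma_mul hw f (primL2 hw v)).congr ?_
    filter_upwards [(ae_muSigma_iff hw).1 (memLp_prim hw v).coeFn_toLp] with x hx
    rw [primL2_apply, hx]
  have h1 : ⟪g, primL2 hw v⟫_ℝ = ∫ x, f x * prim v x * (1 / sigma a b x) ∂vol01
      + lam * weightForm hwd (dxL a b u) v := by
    rw [primL2_apply, inner_toLp_prim hw, weightForm_apply, ← integral_const_mul,
      ← integral_add hi ((hwd.integrable _ _).const_mul lam)]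
    refine integral_congr_ae ?_
    filter_upwards [h.2] with x hx
    have hx' : g x = f x + lam * prim (dxL a b u) x / d x := hx
    rw [hx', one_div, one_div, mul_inv]
    ring
  rw [h1, inner_eq_of_hasOpA hw he h.1, energyForm_apply]
  simp only [dxL_apply]
  ring

theorem energy_eq (hw : IsWeight fun x => 1 / sigma a b x)
    (hwd : IsWeight fun x => 1 / (sigma a b x * d x)) (he : ContinuousOn (eta a b) (Icc 0 1))
    (y : ℝ → H1Sigma0 a b) (t : ℝ) :
    energy d lam β y t
      = 1 / 2 * (‖dt y t‖ ^ 2 + energyForm hwd he lam β (dxL a b (y t)) (dxL a b (y t))) := by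
  set v := dxL a b (y t) with hv
  have h1 : ‖dt y t‖ ^ 2 = ∫ x, dt y t x * dt y t x * (1 / sigma a b x) ∂vol01 := by
    rw [← real_inner_self_eq_norm_sq, inner_L2Sigma hw]
  have hadd : Integrable (fun x => dt y t x * dt y t x * (1 / sigma a b x)
      + eta a b x * (v x * v x)) vol01 :=
    (integrable_L2Sigma_mul hw _ _).add (integrable_mul_coe he v v)
  have h2 : ∫ x in (0 : ℝ)..1, ((dt y t) x ^ 2 / sigma a b x + eta a b x * dx (y t) x ^ 2
      - lam / (sigma a b x * d x) * val (y t) x ^ 2)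
      = ‖dt y t‖ ^ 2 + coeffForm he v v - lam * weightForm hwd v v := by
    rw [h1, coeffForm_apply, weightForm_apply, integral_zero_one_eq, ← integral_const_mul,
      ← integral_add (integrable_L2Sigma_mul hw _ _) (integrable_mul_coe he v v),
      ← integral_sub hadd ((hwd.integrable v v).const_mul lam)]
    refine integral_congr_ae (ae_of_all _ fun x => ?_)
    have h3 : dx (y t) x = v x := rfl
    have h4 : val (y t) x = prim v x := rfl
    simp only [h3, h4]
    ring
  have h5 : val (y t) 1 = evalOne v := rfl
  rw [energy, h2, h5, energyForm_apply]
  ring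

theorem IsClassicalSolution.hasDerivWithinAt {y₀ : H1Sigma0 a b} {y₁ : L2Sigma a b}
    {y : ℝ → H1Sigma0 a b} (hy : IsClassicalSolution d lam β y₀ y₁ y) {t : ℝ} (ht : 0 ≤ t) :
    HasDerivWithinAt y (derivWithin y (Ici 0) t) (Ici 0) t :=
  (hy.c1_H1.differentiableOn (by norm_num) t ht).hasDerivWithinAt

/-- The continuous embedding commutes with the time derivative, so y_t in L²_{1/σ} has a trace at 1,
that of the derivative taken in H¹. -/
theorem IsClassicalSolution.dt_eq {y₀ : H1Sigma0 a b} {y₁ : L2Sigma a b}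
    {y : ℝ → H1Sigma0 a b} (hy : IsClassicalSolution d lam β y₀ y₁ y)
    (hw : IsWeight fun x => 1 / sigma a b x) {t : ℝ} (ht : 0 ≤ t) :
    dt y t = primL2 hw (dxL a b (derivWithin y (Ici 0) t)) := by
  have h := (toL2L a b).hasFDerivAt.comp_hasDerivWithinAt t (hy.hasDerivWithinAt ht)
  exact (h.derivWithin (uniqueDiffOn_Ici 0 t ht)).trans (toL2_eq_primL2 hw _)

theorem IsClassicalSolution.hasDerivAt_dt {y₀ : H1Sigma0 a b} {y₁ : L2Sigma a b}
    {y : ℝ → H1Sigma0 a b} (hy : IsClassicalSolution d lam β y₀ y₁ y) {t : ℝ} (ht : 0 < t) :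
    HasDerivAt (dt y) (dtt y t) t := by
  have h : ContDiffOn ℝ 1 (dt y) (Ici 0) :=
    hy.c2_L2.derivWithin (uniqueDiffOn_Ici 0) (by norm_num)
  exact (h.differentiableOn (by norm_num) t ht.le).hasDerivWithinAt.hasDerivAt (Ici_mem_nhds ht)

end Solution
end
end DegWave

/-! ### The estimate for the boundary trace -/

theorem proposition3p4 (a b d : ℝ → ℝ) (lam Ka Kd β : ℝ)
    (hyp : DegWave.Assumptions a b d lam Ka Kd) (hβ : 0 ≤ β)
    (y₀ : DegWave.H1Sigma0 a b) (y₁ : DegWave.L2Sigma a b) (y : ℝ → DegWave.H1Sigma0 a b)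
    (hy : DegWave.IsClassicalSolution d lam β y₀ y₁ y) :
    0 < DegWave.oneEps a b d lam ∧ DegWave.oneEps a b d lam ≤ 1 ∧
    ∀ s T δ : ℝ, 0 < s → s < T → 0 < δ →
      ∫ t in s..T, DegWave.val (y t) 1 ^ 2 ≤
        (2 / DegWave.oneEps a b d lam *
            (1 + DegWave.hardyTilde a b * DegWave.cLam a b d lam ^ 2
              / (DegWave.oneEps a b d lam * DegWave.etaMin a b ^ 2))
          + 1 / (2 * δ)
          + 1 / (2 * δ) * (DegWave.hardyTilde a b + DegWave.etaMax a b)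
              * DegWave.cLam a b d lam ^ 4) * DegWave.energy d lam β y s
        + δ / DegWave.oneEps a b d lam *
            (1 + 1 / (DegWave.oneEps a b d lam * DegWave.etaMin a b ^ 2)
              * DegWave.cLam a b d lam ^ 2)
          * ∫ t in s..T, DegWave.energy d lam β y t := by
  open DegWave in
  obtain ⟨he0, he1⟩ := oneEps_mem hyp.lam_lt
  refine ⟨he0, he1, fun s T δ hs hsT hδ => ?_⟩
  have ha := PowerLower.of_degenerate hyp.deg_a
  have hd := PowerLower.of_degenerate hyp.deg_d
  -- The inequality is strict because K_d > 0.
  have hK : Ka + Kd < 2 := by linarith [hyp.exps, hd.exp_pos]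
  have hw := isWeight_sigma ha hyp.int_ba
  have hwd := isWeight_sigma_mul ha hd hK hyp.int_ba
  have he := continuousOn_eta hyp.int_ba
  have hm := etaMin_pos hyp.int_ba
  have hM := etaMax_pos hyp.int_ba
  have hC : 0 ≤ hardyTilde a b := hardyTilde_nonneg
  have hk2 := cLam_sq hyp.lam_lt hm
  have hk4 : cLam a b d lam ^ 4 = (cLam a b d lam ^ 2) ^ 2 := by ring
  set e := oneEps a b d lam
  set m := etaMin a b
  set M := etaMax a b
  set C := hardyTilde a b
  -- The inverse of the coercivity constant, equal to C_λ² by `cLam_sq`.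
  set k : ℝ := 1 / (e * m) with hk
  have hem : 0 < e * m := mul_pos he0 hm
  have hk0 : 0 < k := one_div_pos.2 hem
  set B := energyForm hwd he lam β with hB
  have hcoer : ∀ v, e * m * ‖v‖ ^ 2 ≤ B v v := fun v =>
    norm_sq_le_energyForm hw hwd he hm (fun x hx => etaMin_le hyp.int_ba hx) hβ hyp.lam_lt v
  have hkB : ∀ v, ‖v‖ ^ 2 ≤ k * B v v := fun v => by
    rw [hk, one_div_mul_eq_div, le_div_iff₀ hem, mul_comm]; exact hcoer v
  obtain ⟨w, hwB⟩ := exists_bilin_eq (B := B)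
    ⟨e * m, hem, fun v => (by ring : e * m * ‖v‖ * ‖v‖ = e * m * ‖v‖ ^ 2).trans_le (hcoer v)⟩
    evalOne
  -- B(w, w) = w(1) gives ‖w'‖² ≤ k w(1), and w(1)² ≤ ‖w'‖²; hence w(1) ≤ k and ‖w'‖ ≤ k.
  have hw2 := hkB w
  rw [hwB] at hw2
  have hw0 : 0 ≤ evalOne w := nonneg_of_mul_nonneg_right ((sq_nonneg _).trans hw2) hk0
  have hw1 : evalOne w ≤ k := by
    have := (evalOne_sq_le w).trans hw2
    nlinarith
  have hwk : ‖w‖ ^ 2 ≤ k ^ 2 := hw2.trans (by nlinarith)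
  have hwD : ‖primL2 hw w‖ ≤ Real.sqrt C * k := by
    refine abs_le_of_sq_le_sq ?_ (mul_nonneg (Real.sqrt_nonneg _) hk0.le)
      |>.trans' (le_abs_self _)
    rw [mul_pow, Real.sq_sqrt hC, primL2_apply, norm_toLp_prim_sq]
    exact (weightForm_le_hardyTilde hw w).trans (mul_le_mul_of_nonneg_left hwk hC)
  obtain ⟨f, g, c, -, -, hop, hg, hbc⟩ := hy.equation
  have hyd : ∀ t, 0 < t → HasDerivAt (fun t => dxL a b (y t))
      (dxL a b (derivWithin y (Ici 0) t)) t := fun t ht =>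
    (dxL a b).hasFDerivAt.comp_hasDerivAt t
      ((hy.hasDerivWithinAt ht.le).hasDerivAt (Ici_mem_nhds ht))
  obtain ⟨hE0, hEi, hmain⟩ := integral_sq_observation_le (primL2 hw) evalOne B
    (energyForm_symm hwd he lam β) hk0 (fun v => (evalOne_sq_le v).trans (hkB v)) hwB hwD hw0 hw1
    hyd (q := dtt y)
    (fun t ht => (hy.hasDerivAt_dt ht).congr_of_eventuallyEq <| by
      filter_upwards [Ioi_mem_nhds ht] with r hr
      exact (hy.dt_eq hw (le_of_lt hr)).symm)
    ((dxL a b).continuous.comp_continuousOn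
      ((hy.c1_H1.continuousOn_derivWithin (uniqueDiffOn_Ici 0) le_rfl).mono Ioi_subset_Ici_self))
    (fun t ht φ => by
      have hb : evalOne (dxL a b (derivWithin y (Ici 0) t)) + c t
        + β * evalOne (dxL a b (y t)) = 0 := hbc t ht
      rw [hg t ht.le, hB, inner_add_energyForm_eq hw hwd he (hop t ht.le) φ]
      linear_combination evalOne φ * hb)
    (E := energy d lam β y)
    (fun t ht => by rw [energy_eq hw hwd he, hy.dt_eq hw ht.le]) hs hsT hδ
  refine hmain.trans ?_
  rw [hk4, hk2, mul_pow, Real.sq_sqrt hC]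
  have h1e : 1 ≤ 1 / e := (one_le_div he0).2 he1
  -- With D² = C k², these identities match the abstract constants D² k and k³ with the stated ones.
  -- The rest is slack: 1 ≤ 1/ε for the leading terms, and the nonnegative summand with max η.
  have hX : C * k / (e * m ^ 2) * (1 / e) = C * k ^ 2 * k := by
    rw [hk]; field_simp
  have hY : 1 / (e * m ^ 2) * k * (1 / e) = k ^ 3 := by
    rw [hk]; field_simp
  refine add_le_add (mul_le_mul_of_nonneg_right ?_ hE0) (mul_le_mul_of_nonneg_right ?_ hEi)
  · have h3 : 2 / e * (1 + C * k / (e * m ^ 2)) = 2 * (1 / e + C * k ^ 2 * k) := by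
      rw [← hX]; ring
    have h4 : 0 ≤ 1 / (2 * δ) * M * k ^ 2 := by positivity
    rw [h3]
    linarith
  · have h3 : δ / e * (1 + 1 / (e * m ^ 2) * k) = δ * (1 / e + k ^ 3) := by
      rw [← hY]; ring
    rw [h3]
    exact mul_le_mul_of_nonneg_left (by linarith) hδ.le
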